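/- Work in the language of groups (a binary operation, inverse, identity; equality is the only relation). A structure is \emph{computable} if its universe is a subset of $\mathbb{N}$ and its atomic diagram, viewed as a set of Gödel numbers, is computable; a \emph{computable subgroup of $\mathbb{Q}$} is an additive subgroup of $\mathbb{Q}$ that is isomorphic to a computable structure (membership of rationals in the subgroup is not required to be decidable). For such $G$, the \emph{index set} $I(G)$ is the set of all $e\in\mathbb{N}$ such that $\varphi_e$ is the characteristic function of the atomic diagram of some structure $B\cong G$ with universe contained in $\mathbb{N}$. Infinitary formulas are in normal form. A formula is \emph{computable $\Sigma_0$} (and \emph{$\Pi_0$}) if it is finitary and quantifier-free; for $n>0$ it is \emph{computable $\Sigma_n$} if it is a disjunction, over a c.e. set of indices, of formulas $(\exists\bar y)\,\psi$ with each $\psi$ computable $\Pi_m$ for some $m<n$, and \emph{computable $\Pi_n$} if it is a conjunction, over a c.e. set of indices, of formulas $(\forall\bar y)\,\psi$ with each $\psi$ computable $\Sigma_m$ for some $m<n$. \emph{$X$-computable $\Sigma_n$} and \emph{$\Pi_n$} formulas are defined in the same way with ``c.e. relative to $X$'' in place of ``c.e.''. A \emph{Scott sentence} for $G$ is a sentence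 whose countable models are exactly the isomorphic copies of $G$. A set $X\le_T\emptyset'$ is \emph{low} if $X'\equiv_T\emptyset'$, and \emph{$2$-high} if $X''\equiv_T\emptyset'''$. A set is \emph{$d$-$\Sigma^0_2$} if it is the difference of two $\Sigma^0_2$ sets. A set $S$ is \emph{$m$-complete $\Sigma^0_3$} if it is $\Sigma^0_3$ and every $\Sigma^0_3$ set is many-one reducible to $S$. \textbf{Proposition.} Let $G$ be a computable subgroup of $\mathbb{Q}$, and fix a nonzero element of $G$, denoted by $1$. Let $$P^{fin}=\{p \text{ prime} : \text{for some } k>0,\ p^k\mid 1 \text{ and } p^{k+1}\nmid 1 \text{ in } G\},\qquad P^{\infty}=\{p\text{ prime} : p^k\mid 1 \text{ in } G\text{ for all } k>0\}.$$ Suppose that $P^{fin}=\emptyset$, and let $X=P^{\infty}$. Then $X$ is c.e., and $G$ has a Scott sentence that is the conjunction of a computable $\Pi_2$ sentence and an $X$-computable $\Sigma_2$ sentence. Furthermore: \begin{enumerate} \item If $X$ is low, then $I(G)$ is $d$-$\Sigma^0_2$. \item If $X$ is not $2$-high, then $I(G)$ is not $m$-complete $\Sigma^0_3$. \end{enumerate}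 -/

import Mathlib

/-! ## Relative computability: oracle programs, c.e. sets, the jump -/

/-- The characteristic function of a set of natural numbers, as a (total) partial function. -/
noncomputable def charFn (X : Set ℕ) : ℕ →. ℕ := by
  classical exact fun n => Part.some (if n ∈ X then 1 else 0)

/-- Turing reducibility between sets of natural numbers (through characteristic functions). -/
def TuringLe (A B : Set ℕ) : Prop := TuringReducible (charFn A) (charFn B)

/-- Turing equivalence between sets of natural numbers. -/
def TuringEq (A B : Set ℕ) : Prop := TuringLe A B ∧ TuringLe B A

/-- Programs with an oracle: one constructor for each clause of `Nat.RecursiveIn`. -/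
inductive OracleCode : Type
  | zero : OracleCode
  | succ : OracleCode
  | left : OracleCode
  | right : OracleCode
  | oracle : OracleCode
  | pair : OracleCode → OracleCode → OracleCode
  | comp : OracleCode → OracleCode → OracleCode
  | prec : OracleCode → OracleCode → OracleCode
  | rfind : OracleCode → OracleCode

namespace OracleCode

/-- The Gödel number of an oracle program (a bijection with `ℕ`). -/
def toNat : OracleCode → ℕ
  | zero => 0
  | succ => 1
  | left => 2
  | right => 3
  | oracle => 4
  | pair c d => 4 * Nat.pair c.toNat d.toNat + 5
  | comp c d => 4 * Nat.pair c.toNat d.toNat + 6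
  | prec c d => 4 * Nat.pair c.toNat d.toNat + 7
  | rfind c => 4 * c.toNat + 8

/-- The partial function computed by an oracle program with oracle `X`. -/
noncomputable def eval (X : Set ℕ) : OracleCode → ℕ →. ℕ
  | zero => fun _ => Part.some 0
  | succ => fun n => Part.some (n + 1)
  | left => fun n => Part.some n.unpair.1
  | right => fun n => Part.some n.unpair.2
  | oracle => charFn X
  | pair c d => fun n => Nat.pair <$> eval X c n <*> eval X d n
  | comp c d => fun n => eval X d n >>= eval X c
  | prec c d => fun p =>
      Nat.rec (motive := fun _ => Part ℕ) (eval X c p.unpair.1)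
        (fun y ih => ih >>= fun i => eval X d (Nat.pair p.unpair.1 (Nat.pair y i)))
        p.unpair.2
  | rfind c => fun a => Nat.rfind fun n => (fun m => m = 0) <$> eval X c (Nat.pair a n)

end OracleCode

/-- `relCE X e` is `W_e^X`, the domain of the `e`-th partial function computable from `X`. -/
def relCE (X : Set ℕ) (e : ℕ) : Set ℕ :=
  {n | ∃ c : OracleCode, c.toNat = e ∧ (c.eval X n).Dom}

/-- The Turing jump `X' = {e | Φ_e^X(e) is defined}`. -/
def jump (X : Set ℕ) : Set ℕ := {e | e ∈ relCE X e}

/-- `X ≤_T ∅'` and `X' ≡_T ∅'`. -/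
def IsLow (X : Set ℕ) : Prop :=
  TuringLe X (jump ∅) ∧ TuringEq (jump X) (jump ∅)

/-- `X ≤_T ∅'` and `X'' ≡_T ∅'''`. -/
def IsTwoHigh (X : Set ℕ) : Prop :=
  TuringLe X (jump ∅) ∧ TuringEq (jump (jump X)) (jump (jump (jump ∅)))

/-- The `e`-th partial computable function `φ_e`. -/
def partialComp (e : ℕ) : ℕ →. ℕ :=
  Nat.Partrec.Code.eval (Denumerable.ofNat Nat.Partrec.Code e)

/-- The `e`-th c.e. set `W_e`, the domain of `φ_e`. -/
def ceSet (e : ℕ) : Set ℕ := {n | (partialComp e n).Dom}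

/-! ## Arithmetical hierarchy and many-one completeness -/

/-- `S` is `Σ⁰_n`: computable for `n = 0`; `∃ x, (a, x) ∈ Q` with `Q` the complement of a
`Σ⁰_n` set (that is, `Q` a `Π⁰_n` set) for `n + 1`. -/
def IsSigma0 : ℕ → Set ℕ → Prop
  | 0, S => ComputablePred fun a => a ∈ S
  | n + 1, S => ∃ R : Set ℕ, IsSigma0 n R ∧ ∀ a, a ∈ S ↔ ∃ x, Nat.pair a x ∈ Rᶜ

/-- `S` is `d-Σ⁰_2`: a difference of two `Σ⁰_2` sets. -/
def IsDSigma02 (S : Set ℕ) : Prop :=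
  ∃ A B : Set ℕ, IsSigma0 2 A ∧ IsSigma0 2 B ∧ S = A \ B

/-- `S` is `m`-complete `Σ⁰_n`. -/
def IsMCompleteSigma0 (n : ℕ) (S : Set ℕ) : Prop :=
  IsSigma0 n S ∧ ∀ T : Set ℕ, IsSigma0 n T → ManyOneReducible (fun a => a ∈ T) (fun a => a ∈ S)

/-! ## The language of groups, structures, atomic diagrams, index sets -/

/-- Function symbols of the language of groups: identity, inverse, group operation. -/
inductive GroupFunc : ℕ → Type
  | one : GroupFunc 0
  | inv : GroupFunc 1
  | mul : GroupFunc 2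

/-- The language of groups; equality is the only relation. -/
def groupLang : FirstOrder.Language.{0, 0} := ⟨GroupFunc, fun _ => Empty⟩

/-- An additive group as a structure for the language of groups. -/
instance addGroupStructure (A : Type) [AddGroup A] : groupLang.Structure A where
  funMap {_} f :=
    match f with
    | GroupFunc.one => fun _ => 0
    | GroupFunc.inv => fun x => -x 0
    | GroupFunc.mul => fun x => x 0 + x 1
  RelMap {_} r := Empty.elim r

/-- Gödel number of a term whose variables are numbered by `v`. -/
def termCode {α : Type} (v : α → ℕ) : groupLang.Term α → ℕ
  | .var a => 4 * v a
  | .func GroupFunc.one _ => 1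
  | .func GroupFunc.inv t => 4 * termCode v (t 0) + 2
  | .func GroupFunc.mul t => 4 * Nat.pair (termCode v (t 0)) (termCode v (t 1)) + 3

/-- The atomic diagram, as a set of Gödel numbers, of a structure with universe `U ⊆ ℕ`: all true
sentences `s = t` and `s ≠ t`, where `s`, `t` are built from names for the elements of `U`
(the name of `a` is the variable `a`, evaluated at `a`). -/
def atomicDiagram (U : Set ℕ) [groupLang.Structure U] : Set ℕ :=
  {n | ∃ s t : groupLang.Term U,
    (n = 2 * Nat.pair (termCode Subtype.val s) (termCode Subtype.val t) ∧
      s.realize id = t.realize id) ∨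
    (n = 2 * Nat.pair (termCode Subtype.val s) (termCode Subtype.val t) + 1 ∧
      s.realize id ≠ t.realize id)}

/-- `M` is (isomorphic to) a computable structure, one with universe a subset of `ℕ` and a
computable atomic diagram. -/
def IsComputableStructure (M : Type) [groupLang.Structure M] : Prop :=
  ∃ (U : Set ℕ) (_ : groupLang.Structure U),
    ComputablePred (fun n => n ∈ atomicDiagram U) ∧ Nonempty (FirstOrder.Language.Equiv groupLang U M)

/-- The index set `I(M)`: all `e` such that `φ_e` is the characteristic function of the atomic
diagram of an isomorphic copy of `M`. -/
def indexSet (M : Type) [groupLang.Structure M] : Set ℕ :=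
  {e | ∃ (U : Set ℕ) (_ : groupLang.Structure U),
    partialComp e = charFn (atomicDiagram U) ∧ Nonempty (FirstOrder.Language.Equiv groupLang U M)}

/-! ## Infinitary formulas in normal form -/

/-- Finitary quantifier-free formulas, in negation normal form, in `k` free variables. -/
inductive QFFormula (k : ℕ) : Type
  | eq : groupLang.Term (Fin k) → groupLang.Term (Fin k) → QFFormula k
  | ne : groupLang.Term (Fin k) → groupLang.Term (Fin k) → QFFormula k
  | and : QFFormula k → QFFormula k → QFFormula k
  | or : QFFormula k → QFFormula k → QFFormula k

namespace QFFormula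

/-- Gödel number of a quantifier-free formula. -/
def code {k : ℕ} : QFFormula k → ℕ
  | eq s t => 4 * Nat.pair (termCode Fin.val s) (termCode Fin.val t)
  | ne s t => 4 * Nat.pair (termCode Fin.val s) (termCode Fin.val t) + 1
  | and φ ψ => 4 * Nat.pair φ.code ψ.code + 2
  | or φ ψ => 4 * Nat.pair φ.code ψ.code + 3

/-- Satisfaction of quantifier-free formulas. -/
def Realize {k : ℕ} {M : Type} [groupLang.Structure M] (v : Fin k → M) : QFFormula k → Prop
  | eq s t => s.realize v = t.realize v
  | ne s t => s.realize v ≠ t.realize v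
  | and φ ψ => φ.Realize v ∧ ψ.Realize v
  | or φ ψ => φ.Realize v ∨ ψ.Realize v

end QFFormula

/-- `L_{ω₁ω}` formulas in normal form with free variables `x_0, …, x_{k-1}`: quantifier-free
formulas, countable disjunctions of formulas `∃ y_1 … y_m φ_i`, and countable conjunctions of
formulas `∀ y_1 … y_m φ_i`, where `m` may depend on `i`. -/
inductive InfFormula : ℕ → Type
  | qf {k : ℕ} (θ : QFFormula k) : InfFormula k
  | disj {k : ℕ} (I : Set ℕ) (m : I → ℕ) (φ : ∀ i : I, InfFormula (k + m i)) : InfFormula k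
  | conj {k : ℕ} (I : Set ℕ) (m : I → ℕ) (φ : ∀ i : I, InfFormula (k + m i)) : InfFormula k

/-- Satisfaction of infinitary formulas. -/
def InfFormula.Realize {M : Type} [groupLang.Structure M] :
    {k : ℕ} → InfFormula k → (Fin k → M) → Prop
  | _, .qf θ, v => θ.Realize v
  | _, .disj I m φ, v => ∃ i : I, ∃ w : Fin (m i) → M, (φ i).Realize (Fin.append v w)
  | _, .conj I m φ, v => ∀ i : I, ∀ w : Fin (m i) → M, (φ i).Realize (Fin.append v w)

/-- A sentence is a formula without free variables. -/
abbrev InfSentence : Type := InfFormula 0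

/-- `M ⊨ φ`. -/
def InfSentence.Holds (φ : InfSentence) (M : Type) [groupLang.Structure M] : Prop :=
  InfFormula.Realize φ (Fin.elim0 : Fin 0 → M)

/-- The two kinds of formulas, `Σ` and `Π`. -/
inductive FormulaKind : Type
  | sigma : FormulaKind
  | pi : FormulaKind

/-- `HasIndex W κ n e φ`: `e` is an index for the formula `φ` as a `Σ_n` formula (or a `Π_n`
formula, according to `κ`) whose infinite disjunctions and conjunctions are over sets in the list
`W 0, W 1, …`. For `n = 0`, `φ` is finitary quantifier-free with Gödel number `e`. For `n > 0`,
a `Σ_n` formula with index `e` is a disjunction over the codes `⟨m, ⟨j, i⟩⟩` in `W e` of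
formulas `∃ y_1 … y_m ψ`, where `j < n` and `ψ` is the `Π_j` formula with index `i`; dually
for `Π_n`. -/
inductive HasIndex (W : ℕ → Set ℕ) :
    FormulaKind → ℕ → ℕ → {k : ℕ} → InfFormula k → Prop
  | qf {k : ℕ} (κ : FormulaKind) (θ : QFFormula k) : HasIndex W κ 0 θ.code (InfFormula.qf θ)
  | disj {k : ℕ} (n e : ℕ)
      (ψ : ∀ c : W e, InfFormula (k + c.1.unpair.1))
      (hlt : ∀ c : W e, c.1.unpair.2.unpair.1 < n + 1)
      (h : ∀ c : W e, HasIndex W FormulaKind.pi c.1.unpair.2.unpair.1 c.1.unpair.2.unpair.2 (ψ c)) :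
      HasIndex W FormulaKind.sigma (n + 1) e
        (InfFormula.disj (W e) (fun c => c.1.unpair.1) ψ)
  | conj {k : ℕ} (n e : ℕ)
      (ψ : ∀ c : W e, InfFormula (k + c.1.unpair.1))
      (hlt : ∀ c : W e, c.1.unpair.2.unpair.1 < n + 1)
      (h : ∀ c : W e,
        HasIndex W FormulaKind.sigma c.1.unpair.2.unpair.1 c.1.unpair.2.unpair.2 (ψ c)) :
      HasIndex W FormulaKind.pi (n + 1) e
        (InfFormula.conj (W e) (fun c => c.1.unpair.1) ψ)

/-- Computable `Π_n` formulas: the conjunctions and disjunctions are over c.e. sets. -/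
def IsComputablePi (n : ℕ) {k : ℕ} (φ : InfFormula k) : Prop :=
  ∃ e, HasIndex ceSet FormulaKind.pi n e φ

/-- `X`-computable `Σ_n` formulas: the conjunctions and disjunctions are over sets that are c.e.
relative to `X`. -/
def IsRelComputableSigma (X : Set ℕ) (n : ℕ) {k : ℕ} (φ : InfFormula k) : Prop :=
  ∃ e, HasIndex (relCE X) FormulaKind.sigma n e φ

/-- `φ ∧ ψ` is a Scott sentence for `M`: its countable models are exactly the isomorphic copies
of `M`. -/
def IsScottConj (φ ψ : InfSentence) (M : Type) [groupLang.Structure M] : Prop :=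
  ∀ (N : Type) [Countable N] [groupLang.Structure N],
    (φ.Holds N ∧ ψ.Holds N) ↔ Nonempty (FirstOrder.Language.Equiv groupLang N M)

/-! ## Divisibility by primes in a subgroup of the rationals -/

/-- The primes `p` such that, for some `k > 0`, `p^k` divides `u` in `A` and `p^(k+1)` does not. -/
def primesFin {A : Type} [AddGroup A] (u : A) : Set ℕ :=
  {p | p.Prime ∧ ∃ k > 0, (∃ y : A, p ^ k • y = u) ∧ ¬ ∃ y : A, p ^ (k + 1) • y = u}

/-- The primes `p` such that `p^k` divides `u` in `A` for all `k > 0`. -/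
def primesInf {A : Type} [AddGroup A] (u : A) : Set ℕ :=
  {p | p.Prime ∧ ∀ k > 0, ∃ y : A, p ^ k • y = u}

-- Since `primesFin u` is empty, a prime that divides `u` divides it infinitely often, so `G` is a
-- copy of the group of rationals whose denominators have all their prime factors in `X`. A
-- computable copy lets one search for a `p`-th part of `u`, so `X` is c.e.
--
-- The algebraic core is `nonempty_equiv_iff`: a structure `M` is isomorphic to `G` exactly when (a)
-- it is a torsion-free abelian group of rank at most one in which every element is divisible by
-- every `p ∈ X` (`IsRankOneDivisible`), and (b) some nontrivial element is divisible by no prime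
-- outside `X` (`HasBase`). Such an element `v` serves as the unit: sending `a` to `z / m` when `m •
-- a = z • v` embeds `M` in `ℚ`, and the image depends on `X` alone (`exists_hom_rat`). Because `X`
-- is c.e., (a) is a computable `Π₂` sentence. Condition (b) is one existential quantifier before a
-- conjunction over primes outside `X`, hence `X`-computable `Σ₂`.
--
-- For the index set, being an atomic diagram and satisfying (a) are lists of universally quantified
-- implications between c.e. conditions, so they are `Π⁰₂` in `e`. Failure of a number to witness
-- (b) is c.e. in `X`, so (b) is c.e. in `X'`. Hence `I(G) = A \ B` with `A` c.e. in `X'` and `B` in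
-- `Σ⁰₂` (`mem_indexSet_iff`). If `X` is low, `A` is c.e. in `∅'`, hence `Σ⁰₂`.
--
-- In general both `A` and `B` are c.e. in `X'`, so both reduce to `X''` and `I(G) ≤_T X''`. If
-- `I(G)` were `m`-complete `Σ⁰₃`, then `∅''' ≤_T X''`; the reverse reduction follows from `X ≤_T
-- ∅'`, and `X` would be 2-high. The supporting recursion theory is the use principle
-- (`OracleCode.evalP_eventually`), the s-m-n reduction to the jump (`CEIn.exists_reduction`) and
-- the passage from relative enumerability to the arithmetical hierarchy (`IsSigma0.of_ceIn`).

attribute [fun_prop] Computable Computable.id Computable.const Computable.comp Computable.fst Computable.snd Computable.pair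

/-! ### Closure properties of computable functions, computable predicates and c.e. predicates -/

namespace Computable
variable {α β γ δ : Type*} [Primcodable α] [Primcodable β] [Primcodable γ] [Primcodable δ]

@[fun_prop] theorem fst_comp {f : α → β × γ} (hf : Computable f) : Computable fun a => (f a).1 :=
  Computable.fst.comp hf
@[fun_prop] theorem snd_comp {f : α → β × γ} (hf : Computable f) : Computable fun a => (f a).2 :=
  Computable.snd.comp hf
@[fun_prop] theorem natPair {f g : α → ℕ} (hf : Computable f) (hg : Computable g) :
    Computable fun a => Nat.pair (f a) (g a) :=
  (Primrec₂.natPair.to_comp : Computable₂ Nat.pair).comp hf hg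
@[fun_prop] theorem natUnpair {f : α → ℕ} (hf : Computable f) :
    Computable fun a => Nat.unpair (f a) := Computable.unpair.comp hf
@[fun_prop] theorem natAdd {f g : α → ℕ} (hf : Computable f) (hg : Computable g) :
    Computable fun a => f a + g a := (Primrec.nat_add.to_comp).comp hf hg
@[fun_prop] theorem natMul {f g : α → ℕ} (hf : Computable f) (hg : Computable g) :
    Computable fun a => f a * g a := (Primrec.nat_mul.to_comp).comp hf hg
@[fun_prop] theorem boolAnd {f g : α → Bool} (hf : Computable f) (hg : Computable g) :
    Computable fun a => (f a && g a) := (Primrec.and.to_comp).comp hf hg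
@[fun_prop] theorem boolOr {f g : α → Bool} (hf : Computable f) (hg : Computable g) :
    Computable fun a => (f a || g a) := (Primrec.or.to_comp).comp hf hg
@[fun_prop] theorem decideNatEq {f g : α → ℕ} (hf : Computable f) (hg : Computable g) :
    Computable fun a => decide (f a = g a) :=
  (Primrec.eq (α := ℕ)).decide.to_comp.comp hf hg
@[fun_prop] theorem condBool {c : α → Bool} {f g : α → β} (hc : Computable c) (hf : Computable f)
    (hg : Computable g) : Computable fun a => bif c a then f a else g a := Computable.cond hc hf hg


theorem exists_eq_true_iff_of_computablePred {p : α → Prop} (hp : ComputablePred p) :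
    ∃ f : α → Bool, Computable f ∧ ∀ a, p a ↔ f a = true := by
  obtain ⟨f, hf, rfl⟩ := ComputablePred.computable_iff.1 hp
  exact ⟨f, hf, fun _ => Iff.rfl⟩

theorem computablePred_of_bool {p : α → Prop} {f : α → Bool} (hf : Computable f)
    (h : ∀ a, p a ↔ f a = true) : ComputablePred p :=
  ComputablePred.computable_iff.2 ⟨f, hf, funext fun a => propext (h a)⟩

end Computable

theorem ComputablePred.comp {α β : Type*} [Primcodable α] [Primcodable β] {p : β → Prop}
    {f : α → β} (hp : ComputablePred p) (hf : Computable f) : ComputablePred fun a => p (f a) := by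
  obtain ⟨g, hg, h⟩ := Computable.exists_eq_true_iff_of_computablePred hp
  exact Computable.computablePred_of_bool (hg.comp hf) fun a => h _

theorem ComputablePred.and {α : Type*} [Primcodable α] {p q : α → Prop}
    (hp : ComputablePred p) (hq : ComputablePred q) : ComputablePred fun a => p a ∧ q a := by
  obtain ⟨f, hf, h⟩ := Computable.exists_eq_true_iff_of_computablePred hp
  obtain ⟨g, hg, h'⟩ := Computable.exists_eq_true_iff_of_computablePred hq
  exact Computable.computablePred_of_bool (f := fun a => f a && g a) (by fun_prop) fun a => by
    simp [h, h']

theorem ComputablePred.or {α : Type*} [Primcodable α] {p q : α → Prop}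
    (hp : ComputablePred p) (hq : ComputablePred q) : ComputablePred fun a => p a ∨ q a :=
  (hp.not.and hq.not).not.of_eq fun a => by tauto

theorem ComputablePred.natEq {α : Type*} [Primcodable α] {f g : α → ℕ} (hf : Computable f)
    (hg : Computable g) : ComputablePred fun a => f a = g a :=
  Computable.computablePred_of_bool (f := fun a => decide (f a = g a)) (by fun_prop) fun a => by simp

theorem ComputablePred.ite' {α β : Type*} [Primcodable α] [Primcodable β] {p : α → Prop}
    [DecidablePred p] (hp : ComputablePred p) {f g : α → β} (hf : Computable f)
    (hg : Computable g) : Computable fun a => if p a then f a else g a := by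
  obtain ⟨c, hc, h⟩ := Computable.exists_eq_true_iff_of_computablePred hp
  refine (hc.cond hf hg).of_eq fun a => ?_
  by_cases ha : p a
  · simp [ha, (h a).1 ha]
  · have : c a = false := by simpa [h] using ha
    simp [ha, this]

namespace REPred
variable {α β : Type*} [Primcodable α] [Primcodable β] {p q : α → Prop}

theorem of_exists_bool {f : α → ℕ → Bool} (hf : Computable fun x : α × ℕ => f x.1 x.2)
    (h : ∀ a, p a ↔ ∃ n, f a n = true) : REPred p := by
  have : Partrec fun a => Nat.rfind fun n => Part.some (f a n) :=
    Partrec.rfind (p := fun a n => Part.some (f a n)) hf.partrec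
  refine this.dom_re.of_eq fun a => ?_
  rw [h]
  exact Nat.rfind_dom'.trans ⟨fun ⟨n, hn, _⟩ => ⟨n, (Part.mem_some_iff.1 hn).symm⟩,
    fun ⟨n, hn⟩ => ⟨n, Part.mem_some_iff.2 hn.symm, fun _ => trivial⟩⟩

/-- Bounded evaluation `evaln` supplies the stages. Monotonicity in the stage lets several searches
share one stage, and primitive recursiveness makes bounded quantification over a list available in
`forall_mem_list`. -/
theorem exists_primrec (hp : REPred p) : ∃ f : α → ℕ → Bool,
    Primrec (fun x : α × ℕ => f x.1 x.2) ∧ (∀ a m n, m ≤ n → f a m = true → f a n = true) ∧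
      ∀ a, p a ↔ ∃ n, f a n = true := by
  obtain ⟨c, hc⟩ := Nat.Partrec.Code.exists_code.1 hp
  refine ⟨fun a n => (Nat.Partrec.Code.evaln n c (Encodable.encode a)).isSome, ?_, ?_, ?_⟩
  · exact Primrec.option_isSome.comp (Nat.Partrec.Code.primrec_evaln.comp
      (f := fun a : (ℕ × Nat.Partrec.Code) × ℕ => Nat.Partrec.Code.evaln a.1.1 a.1.2 a.2)
      (g := fun x : α × ℕ => ((x.2, c), Encodable.encode x.1))
      ((Primrec.snd.pair (Primrec.const c)).pair (Primrec.encode.comp Primrec.fst)))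
  · intro a m n hmn h
    obtain ⟨x, hx⟩ := Option.isSome_iff_exists.1 h
    exact Option.isSome_iff_exists.2 ⟨x, Nat.Partrec.Code.evaln_mono hmn hx⟩
  · intro a
    have h1 : p a ↔ (c.eval (Encodable.encode a)).Dom := by
      rw [hc]; simp [Part.assert, Part.bind]
    rw [h1, Part.dom_iff_mem]
    simp only [Nat.Partrec.Code.evaln_complete, Option.isSome_iff_exists]
    exact exists_comm

theorem exists_bool (hp : REPred p) : ∃ f : α → ℕ → Bool,
    Computable (fun x : α × ℕ => f x.1 x.2) ∧ (∀ a m n, m ≤ n → f a m = true → f a n = true) ∧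
      ∀ a, p a ↔ ∃ n, f a n = true := by
  obtain ⟨f, hf, h⟩ := hp.exists_primrec
  exact ⟨f, hf.to_comp, h⟩

theorem comp {p : β → Prop} {f : α → β} (hp : REPred p) (hf : Computable f) :
    REPred fun a => p (f a) :=
  Partrec.comp hp hf

theorem and (hp : REPred p) (hq : REPred q) : REPred fun a => p a ∧ q a := by
  obtain ⟨f, hf, mf, h⟩ := hp.exists_bool
  obtain ⟨g, hg, mg, h'⟩ := hq.exists_bool
  refine of_exists_bool (f := fun a n => f a n && g a n) (by fun_prop) fun a => ?_
  simp only [h, h', Bool.and_eq_true]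
  exact ⟨fun ⟨⟨m, hm⟩, n, hn⟩ => ⟨max m n, mf _ _ _ (le_max_left _ _) hm,
    mg _ _ _ (le_max_right _ _) hn⟩, fun ⟨n, h1, h2⟩ => ⟨⟨n, h1⟩, n, h2⟩⟩

theorem or (hp : REPred p) (hq : REPred q) : REPred fun a => p a ∨ q a := by
  obtain ⟨f, hf, mf, h⟩ := hp.exists_bool
  obtain ⟨g, hg, mg, h'⟩ := hq.exists_bool
  refine of_exists_bool (f := fun a n => f a n || g a n) (by fun_prop) fun a => ?_
  simp only [h, h', Bool.or_eq_true, exists_or]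

theorem exists_nat {p : α × ℕ → Prop} (hp : REPred p) : REPred fun a => ∃ n, p (a, n) := by
  obtain ⟨f, hf, mf, h⟩ := hp.exists_bool
  refine of_exists_bool (f := fun a n => f (a, n.unpair.1) n.unpair.2) (by fun_prop) fun a => ?_
  simp only [h]
  exact ⟨fun ⟨m, n, hn⟩ => ⟨Nat.pair m n, by simpa using hn⟩, fun ⟨n, hn⟩ => ⟨_, _, hn⟩⟩

/-- A list is finite, so the maximum of the stages of its members works for all of them at once. -/
theorem forall_mem_list (hp : REPred p) : REPred fun l : List α => ∀ a ∈ l, p a := by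
  obtain ⟨f, hf, mf, h⟩ := hp.exists_primrec
  have h1 : PrimrecRel fun (a : α) (n : ℕ) => f a n = true :=
    Primrec.eq.comp hf (Primrec.const true)
  obtain ⟨_, h3⟩ := h1.forall_mem_list.computablePred
  refine of_exists_bool (f := fun l n => decide (∀ a ∈ l, f a n = true))
    (h3.of_eq fun _ => by congr) fun l => ?_
  simp only [h, decide_eq_true_eq]
  constructor
  · intro H
    induction l with
    | nil => exact ⟨0, by simp⟩
    | cons b l ih =>
      obtain ⟨m, hm⟩ := ih fun a ha => H a (List.mem_cons_of_mem _ ha)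
      obtain ⟨n, hn⟩ := H b List.mem_cons_self
      refine ⟨max m n, fun a ha => ?_⟩
      rcases List.mem_cons.1 ha with rfl | ha
      · exact mf _ _ _ (le_max_right _ _) hn
      · exact mf _ _ _ (le_max_left _ _) (hm a ha)
  · rintro ⟨n, hn⟩ a ha
    exact ⟨n, hn a ha⟩

end REPred

/-- The values of `charFn`, as a total function. -/
noncomputable def chi (X : Set ℕ) (n : ℕ) : ℕ := by
  classical exact if n ∈ X then 1 else 0

theorem charFn_eq (X : Set ℕ) : charFn X = fun n => Part.some (chi X n) := rfl

theorem chi_of_mem {X : Set ℕ} {n : ℕ} (h : n ∈ X) : chi X n = 1 := by simp [chi, h]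
theorem chi_of_notMem {X : Set ℕ} {n : ℕ} (h : n ∉ X) : chi X n = 0 := by simp [chi, h]

theorem chi_eq_one_iff {X : Set ℕ} {n : ℕ} : chi X n = 1 ↔ n ∈ X := by
  by_cases h : n ∈ X <;> simp [chi, h]
theorem chi_eq_zero_iff {X : Set ℕ} {n : ℕ} : chi X n = 0 ↔ n ∉ X := by
  by_cases h : n ∈ X <;> simp [chi, h]

/-! ### Oracle programs: continuity in the oracle and substitution of a program for the oracle -/

namespace OracleCode
open Nat.Partrec (Code)

/-- The partial function computed by an oracle program whose oracle is a partial function. -/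
noncomputable def evalP (g : ℕ →. ℕ) : OracleCode → ℕ →. ℕ
  | zero => fun _ => Part.some 0
  | succ => fun n => Part.some (n + 1)
  | left => fun n => Part.some n.unpair.1
  | right => fun n => Part.some n.unpair.2
  | oracle => g
  | pair c d => fun n => Nat.pair <$> evalP g c n <*> evalP g d n
  | comp c d => fun n => evalP g d n >>= evalP g c
  | prec c d => fun p =>
      Nat.rec (motive := fun _ => Part ℕ) (evalP g c p.unpair.1)
        (fun y ih => ih >>= fun i => evalP g d (Nat.pair p.unpair.1 (Nat.pair y i)))
        p.unpair.2
  | rfind c => fun a => Nat.rfind fun n => (fun m => m = 0) <$> evalP g c (Nat.pair a n)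

theorem eval_eq_evalP (X : Set ℕ) (c : OracleCode) : c.eval X = c.evalP (charFn X) := by
  induction c <;> simp_all [eval, evalP] <;> rfl

/-- The program with the oracle replaced by the program `d`. -/
def specialize (d : Code) : OracleCode → Code
  | zero => Code.zero
  | succ => Code.succ
  | left => Code.left
  | right => Code.right
  | oracle => d
  | pair a b => Code.pair (a.specialize d) (b.specialize d)
  | comp a b => Code.comp (a.specialize d) (b.specialize d)
  | prec a b => Code.prec (a.specialize d) (b.specialize d)
  -- `Code.rfind'` searches upward from the second component of its input, so it is started at `⟨a,
  -- 0⟩`.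
  | rfind a => Code.comp (Code.rfind' (a.specialize d)) (Code.pair Code.id Code.zero)

theorem eval_specialize (d : Code) (c : OracleCode) : (c.specialize d).eval = c.evalP d.eval := by
  induction c with
  | zero => rfl
  | succ => rfl
  | left => rfl
  | right => rfl
  | oracle => rfl
  | pair a b iha ihb => simp [specialize, Code.eval, evalP, iha, ihb]; rfl
  | comp a b iha ihb => simp [specialize, Code.eval, evalP, iha, ihb]; rfl
  | prec a b iha ihb =>
    funext p
    simp [specialize, Code.eval, evalP, iha, ihb]
  | rfind a iha =>
    funext p
    simp [specialize, Code.eval, evalP, iha, Seq.seq, Code.eval_id, pure, PFun.pure]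
    exact Part.map_id' (fun _ => rfl) _

/-- The use principle in filter form: a halting computation consults the oracle finitely often, so
it survives whenever each single answer eventually does. At `atTop` this gives approximation by
finite segments; with a one-point index set it gives monotonicity in the oracle. -/
theorem evalP_eventually {ι : Type*} {l : Filter ι} {G : ι → ℕ →. ℕ} {h : ℕ →. ℕ}
    (H : ∀ n v, v ∈ h n → ∀ᶠ s in l, v ∈ G s n) (c : OracleCode) :
    ∀ n v, v ∈ c.evalP h n → ∀ᶠ s in l, v ∈ c.evalP (G s) n := by
  induction c with
  | zero => intro n v hv; exact Filter.Eventually.of_forall fun _ => hv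
  | succ => intro n v hv; exact Filter.Eventually.of_forall fun _ => hv
  | left => intro n v hv; exact Filter.Eventually.of_forall fun _ => hv
  | right => intro n v hv; exact Filter.Eventually.of_forall fun _ => hv
  | oracle => exact H
  | pair a b iha ihb =>
    intro n v hv
    simp only [evalP, Seq.seq, Part.mem_bind_iff, Part.mem_map_iff, Part.map_eq_map] at hv ⊢
    obtain ⟨f, ⟨x, hx, rfl⟩, y, hy, rfl⟩ := hv
    filter_upwards [iha _ _ hx, ihb _ _ hy] with s h1 h2
    exact ⟨_, ⟨x, h1, rfl⟩, y, h2, rfl⟩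
  | comp a b iha ihb =>
    intro n v hv
    obtain ⟨x, hx, hv⟩ := Part.mem_bind_iff.1 hv
    filter_upwards [ihb _ _ hx, iha _ _ hv] with s h1 h2
    exact Part.mem_bind_iff.2 ⟨x, h1, h2⟩
  | prec a b iha ihb =>
    intro p
    simp only [evalP]
    induction p.unpair.2 with
    | zero => exact iha _
    | succ k ih =>
      intro v hv
      obtain ⟨x, hx, hv⟩ := Part.mem_bind_iff.1 hv
      filter_upwards [ih _ hx, ihb _ _ hv] with s h1 h2
      exact Part.mem_bind_iff.2 ⟨x, h1, h2⟩
  | rfind a iha =>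
    intro n v hv
    have key : ∀ m b, b ∈ ((fun m => decide (m = 0)) <$> a.evalP h (Nat.pair n m) : Part Bool) →
        ∀ᶠ s in l, b ∈ ((fun m => decide (m = 0)) <$> a.evalP (G s) (Nat.pair n m) : Part Bool) := by
      intro m b hb
      obtain ⟨x, hx, rfl⟩ := (Part.mem_map_iff _).1 hb
      filter_upwards [iha _ _ hx] with s h1
      exact (Part.mem_map_iff _).2 ⟨x, h1, rfl⟩
    have h1 := key v true (Nat.rfind_spec hv)
    -- An unbounded search that stops at `v` makes only finitely many failing tests, so their
    -- eventual truths can be intersected.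
    have h2 : ∀ᶠ s in l, ∀ m ∈ Set.Iio v,
        false ∈ ((fun m => decide (m = 0)) <$> a.evalP (G s) (Nat.pair n m) : Part Bool) :=
      (Filter.eventually_all_finite (Set.finite_Iio v)).2 fun m hm =>
        key m false (Nat.rfind_min hv hm)
    filter_upwards [h1, h2] with s h1 h2
    exact Nat.mem_rfind.2 ⟨h1, fun {m} hm => h2 m hm⟩

theorem evalP_mono {g h : ℕ →. ℕ} (H : ∀ n v, v ∈ h n → v ∈ g n) (c : OracleCode) {n v : ℕ}
    (hv : v ∈ c.evalP h n) : v ∈ c.evalP g n := by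
  have := evalP_eventually (l := (⊤ : Filter Unit)) (G := fun _ => g)
    (fun n v hv => Filter.Eventually.of_forall fun _ => H n v hv) c n v hv
  exact this.exists.choose_spec

theorem toNat_injective : Function.Injective toNat := by
  intro c
  induction c with
  | zero | succ | left | right | oracle =>
    intro d h; cases d <;> simp [toNat] at h ⊢
  | pair a b iha ihb | comp a b iha ihb | prec a b iha ihb =>
    intro d h
    cases d <;> simp only [toNat] at h <;> try omega
    rename_i a' b'
    have h1 : Nat.pair a.toNat b.toNat = Nat.pair a'.toNat b'.toNat := by omega
    rw [Nat.pair_eq_pair] at h1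
    rw [iha h1.1, ihb h1.2]
  | rfind a iha =>
    intro d h
    cases d <;> simp only [toNat] at h <;> try omega
    rename_i a'
    rw [iha (by omega : a.toNat = a'.toNat)]

theorem toNat_surjective : Function.Surjective toNat := by
  intro n
  induction n using Nat.strong_induction_on with
  | _ n ih =>
    by_cases hn : n < 5
    · interval_cases n
      exacts [⟨zero, rfl⟩, ⟨succ, rfl⟩, ⟨left, rfl⟩, ⟨right, rfl⟩, ⟨oracle, rfl⟩]
    · obtain ⟨m, r, hr, rfl⟩ : ∃ m r, r < 4 ∧ n = 4 * m + (5 + r) :=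
        ⟨(n - 5) / 4, (n - 5) % 4, by omega, by omega⟩
      have h1 := Nat.unpair_left_le m
      have h2 := Nat.unpair_right_le m
      obtain ⟨a, ha⟩ := ih m.unpair.1 (by omega)
      obtain ⟨b, hb⟩ := ih m.unpair.2 (by omega)
      obtain ⟨c, hc⟩ := ih m (by omega)
      interval_cases r
      exacts [⟨pair a b, by simp [toNat, ha, hb]⟩, ⟨comp a b, by simp [toNat, ha, hb]⟩,
        ⟨prec a b, by simp [toNat, ha, hb]⟩, ⟨rfind c, by simp [toNat, hc]⟩]

/-- The oracle program with a given Gödel number. -/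
noncomputable def ofNat : ℕ → OracleCode := Function.surjInv toNat_surjective

@[simp] theorem toNat_ofNat (n : ℕ) : (ofNat n).toNat = n := Function.surjInv_eq _ n

@[simp] theorem ofNat_toNat (c : OracleCode) : ofNat c.toNat = c := toNat_injective (by simp)

/-- One step of the computation of `specialize` on Gödel numbers. -/
def specializeStep (d : Code) (l : List Code) : Code :=
  let n := l.length
  let m := (n - 5) / 4
  let r := (n - 5) % 4
  let a := l.getD m.unpair.1 Code.zero
  let b := l.getD m.unpair.2 Code.zero
  bif decide (n = 0) then Code.zero
  else bif decide (n = 1) then Code.succ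
  else bif decide (n = 2) then Code.left
  else bif decide (n = 3) then Code.right
  else bif decide (n = 4) then d
  else bif decide (r = 0) then Code.pair a b
  else bif decide (r = 1) then Code.comp a b
  else bif decide (r = 2) then Code.prec a b
  else Code.comp (Code.rfind' (l.getD m Code.zero)) (Code.pair Code.id Code.zero)

/-- Course-of-values recursion on the Gödel number: the list of earlier results has the current
number as its length, and every immediate subprogram has a smaller number. -/
theorem computable_specialize :
    Computable fun x : Code × ℕ => (ofNat x.2).specialize x.1 := by
  have hd : ∀ k, Computable fun n : ℕ => (n - 5) / (k + 1) := fun k =>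
    (Primrec.nat_div.comp (Primrec.nat_sub.comp Primrec.id (Primrec.const 5))
      (Primrec.const (k + 1))).to_comp
  have hm : ∀ k, Computable fun n : ℕ => (n - 5) % (k + 1) := fun k =>
    (Primrec.nat_mod.comp (Primrec.nat_sub.comp Primrec.id (Primrec.const 5))
      (Primrec.const (k + 1))).to_comp
  have hl : Computable fun x : Code × List Code => x.2.length :=
    Computable.list_length.comp Computable.snd
  have hdl := (hd 3).comp hl
  have hml := (hm 3).comp hl
  have hg : ∀ {f : Code × List Code → ℕ}, Computable f →
      Computable fun x : Code × List Code => x.2.getD (f x) Code.zero := fun hf =>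
    (Primrec.list_getD Code.zero).to_comp.comp Computable.snd hf
  have ha := hg (Computable.fst.comp (Computable.unpair.comp hdl))
  have hb := hg (Computable.snd.comp (Computable.unpair.comp hdl))
  have hstep : Computable₂ fun (d : Code) (l : List Code) => Option.some (specializeStep d l) := by
    refine Computable.option_some.comp ?_
    refine Computable.cond (Computable.decideNatEq hl (Computable.const 0)) (Computable.const _) ?_
    refine Computable.cond (Computable.decideNatEq hl (Computable.const 1)) (Computable.const _) ?_
    refine Computable.cond (Computable.decideNatEq hl (Computable.const 2)) (Computable.const _) ?_
    refine Computable.cond (Computable.decideNatEq hl (Computable.const 3)) (Computable.const _) ?_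
    refine Computable.cond (Computable.decideNatEq hl (Computable.const 4)) Computable.fst ?_
    refine Computable.cond (Computable.decideNatEq hml (Computable.const 0))
      (Code.primrec₂_pair.to_comp.comp ha hb) ?_
    refine Computable.cond (Computable.decideNatEq hml (Computable.const 1))
      (Code.primrec₂_comp.to_comp.comp ha hb) ?_
    refine Computable.cond (Computable.decideNatEq hml (Computable.const 2))
      (Code.primrec₂_prec.to_comp.comp ha hb) ?_
    exact Code.primrec₂_comp.to_comp.comp (Code.primrec_rfind'.to_comp.comp (hg hdl))
      (Computable.const _)
  refine Computable.nat_strong_rec (fun d n => (ofNat n).specialize d) hstep fun d n => ?_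
  obtain ⟨c, rfl⟩ := toNat_surjective n
  -- Lookups occur only at numbers of proper subprograms, so the default `Code.zero` is never used
  -- in a branch that matters.
  have key : ∀ m < c.toNat, ((List.range c.toNat).map fun n => (ofNat n).specialize d).getD m
      Code.zero = (ofNat m).specialize d := fun m hm => by
    simp [List.getD, hm]
  congr 1
  have lt1 : ∀ a b : ℕ, a < 4 * Nat.pair a b + 5 := fun a b => by
    have := Nat.left_le_pair a b; omega
  have lt2 : ∀ a b : ℕ, b < 4 * Nat.pair a b + 5 := fun a b => by
    have := Nat.right_le_pair a b; omega
  cases c with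
  | zero | succ | left | right | oracle =>
    rw [ofNat_toNat]; simp [specializeStep, toNat, specialize]
  | pair a b =>
    have h1 := key a.toNat (by have := lt1 a.toNat b.toNat; simp only [toNat]; omega)
    have h2 := key b.toNat (by have := lt2 a.toNat b.toNat; simp only [toNat]; omega)
    rw [ofNat_toNat] at h1 h2 ⊢
    simp only [specializeStep, List.length_map, List.length_range, specialize]
    rw [← h1, ← h2]
    simp [toNat]
  | comp a b =>
    have h1 := key a.toNat (by have := lt1 a.toNat b.toNat; simp only [toNat]; omega)
    have h2 := key b.toNat (by have := lt2 a.toNat b.toNat; simp only [toNat]; omega)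
    rw [ofNat_toNat] at h1 h2 ⊢
    simp only [specializeStep, List.length_map, List.length_range, specialize]
    rw [← h1, ← h2]
    simp [toNat, Nat.mul_add_div]
  | prec a b =>
    have h1 := key a.toNat (by have := lt1 a.toNat b.toNat; simp only [toNat]; omega)
    have h2 := key b.toNat (by have := lt2 a.toNat b.toNat; simp only [toNat]; omega)
    rw [ofNat_toNat] at h1 h2 ⊢
    simp only [specializeStep, List.length_map, List.length_range, specialize]
    rw [← h1, ← h2]
    simp [toNat, Nat.mul_add_div]
  | rfind a =>
    have h1 := key a.toNat (by simp only [toNat]; omega)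
    rw [ofNat_toNat] at h1 ⊢
    simp only [specializeStep, List.length_map, List.length_range, specialize]
    rw [← h1]
    simp [toNat, Nat.mul_add_div]

end OracleCode

/-! ### Finite oracles and the use principle -/

open Nat.Partrec (Code)

/-- The finite initial segment of length `s` of the characteristic function of `Y`, as a list of
argument-value pairs. -/
noncomputable def seg (Y : Set ℕ) : ℕ → List ℕ
  | 0 => []
  | s + 1 => Nat.pair s (chi Y s) :: seg Y s

theorem mem_seg {Y : Set ℕ} {s z : ℕ} : z ∈ seg Y s ↔ ∃ i < s, z = Nat.pair i (chi Y i) := by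
  induction s with
  | zero => simp [seg]
  | succ s ih =>
    simp only [seg, List.mem_cons, ih, Nat.lt_succ_iff_lt_or_eq]
    constructor
    · rintro (rfl | ⟨i, hi, rfl⟩)
      exacts [⟨s, Or.inr rfl, rfl⟩, ⟨i, Or.inl hi, rfl⟩]
    · rintro ⟨i, hi | rfl, rfl⟩
      exacts [Or.inr ⟨i, hi, rfl⟩, Or.inl rfl]

/-- The graph of the characteristic function of `Y`. -/
def graphChi (Y : Set ℕ) : Set ℕ := {z | z.unpair.2 = chi Y z.unpair.1}

theorem seg_subset_graphChi {Y : Set ℕ} {s z : ℕ} (h : z ∈ seg Y s) : z ∈ graphChi Y := by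
  obtain ⟨i, -, rfl⟩ := mem_seg.1 h
  simp [graphChi]

/-- The finite partial function with values in `{0, 1}` whose graph is listed in `σ`. -/
def lookupPart (σ : List ℕ) (n : ℕ) : Option ℕ :=
  if Nat.pair n 1 ∈ σ then some 1 else if Nat.pair n 0 ∈ σ then some 0 else none

theorem mem_charFn_of_mem_lookupPart {Y : Set ℕ} {σ : List ℕ} (hσ : ∀ z ∈ σ, z ∈ graphChi Y)
    {n v : ℕ} (h : v ∈ (lookupPart σ n : Part ℕ)) : v ∈ charFn Y n := by
  rw [charFn_eq]
  unfold lookupPart at h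
  split_ifs at h with h1 h2
  · have := hσ _ h1
    simp_all [graphChi]
  · have := hσ _ h2
    simp_all [graphChi]
  · simp at h

theorem eventually_mem_lookupPart_seg {Y : Set ℕ} {n v : ℕ} (h : v ∈ charFn Y n) :
    ∀ᶠ s in Filter.atTop, v ∈ (lookupPart (seg Y s) n : Part ℕ) := by
  rw [charFn_eq, Part.mem_some_iff] at h
  subst h
  filter_upwards [Filter.eventually_gt_atTop n] with s hs
  have key : ∀ b, Nat.pair n b ∈ seg Y s ↔ b = chi Y n := fun b => by
    rw [mem_seg]
    constructor
    · rintro ⟨i, -, h⟩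
      obtain ⟨rfl, rfl⟩ := Nat.pair_eq_pair.1 h
      rfl
    · rintro rfl
      exact ⟨n, hs, rfl⟩
  simp only [lookupPart, key]
  by_cases h : n ∈ Y <;> simp [chi, h]

theorem computable_list_mem : ComputablePred fun x : ℕ × List ℕ => x.1 ∈ x.2 := by
  have : PrimrecRel fun (l : List ℕ) (b : ℕ) => ∃ a ∈ l, a = b := Primrec.eq.exists_mem_list
  refine ((this.comp Primrec.snd Primrec.fst).computablePred).of_eq fun x => ?_
  simp

/-- Decoding of a list of natural numbers. -/
def toList (n : ℕ) : List ℕ := Denumerable.ofNat (List ℕ) n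

@[simp] theorem toList_encode (l : List ℕ) : toList (Encodable.encode l) = l :=
  Denumerable.ofNat_encode l

@[fun_prop] theorem computable_toList {α : Type*} [Primcodable α] {f : α → ℕ}
    (hf : Computable f) : Computable fun a => toList (f a) :=
  (Computable.ofNat (List ℕ)).comp hf

theorem computable_lookupPart : Computable fun x : ℕ × ℕ => lookupPart (toList x.1) x.2 := by
  have h : ∀ k, ComputablePred fun x : ℕ × ℕ => Nat.pair x.2 k ∈ toList x.1 := fun k =>
    computable_list_mem.comp (f := fun x : ℕ × ℕ => (Nat.pair x.2 k, toList x.1)) (by fun_prop)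
  exact (h 1).ite' (Computable.const _) ((h 0).ite' (Computable.const _) (Computable.const _))

/-- A program for the finite function coded by `n`. -/
theorem exists_lookupCode : ∃ d : ℕ → Code, Computable d ∧
    ∀ n m, (d n).eval m = lookupPart (toList n) m := by
  have h : Nat.Partrec fun z => (lookupPart (toList z.unpair.1) z.unpair.2 : Part ℕ) :=
    Partrec.nat_iff.1 (computable_lookupPart.comp Computable.unpair).ofOption
  obtain ⟨c, hc⟩ := Code.exists_code.1 h
  refine ⟨fun n => Code.curry c n,
    Code.primrec₂_curry.to_comp.comp (Computable.const c) Computable.id, fun n m => ?_⟩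
  rw [Code.eval_curry, hc]
  simp

/-- Halting of the `e`-th oracle program on `a` with the finite oracle coded by `σ`. -/
def oracleHalts (e σ a : ℕ) : Prop :=
  ((OracleCode.ofNat e).evalP (fun n => (lookupPart (toList σ) n : Part ℕ)) a).Dom

theorem rePred_oracleHalts : REPred fun x : (ℕ × ℕ) × ℕ => oracleHalts x.1.1 x.1.2 x.2 := by
  obtain ⟨d, hd, h⟩ := exists_lookupCode
  have h1 : Computable fun x : (ℕ × ℕ) × ℕ => (OracleCode.ofNat x.1.1).specialize (d x.1.2) :=
    OracleCode.computable_specialize.comp (f := fun x : Code × ℕ => _)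
      (g := fun x : (ℕ × ℕ) × ℕ => (d x.1.2, x.1.1)) (by fun_prop)
  refine (Code.eval_part.comp h1 Computable.snd).dom_re.of_eq fun x => ?_
  rw [OracleCode.eval_specialize, oracleHalts, show (d x.1.2).eval = _ from funext (h _)]

/-- Initial segments are computable from `Y`, so this form serves to enumerate sets relative to `Y`.
-/
theorem dom_eval_iff_exists_seg (Y : Set ℕ) (c : OracleCode) (a : ℕ) :
    (c.eval Y a).Dom ↔ ∃ s, oracleHalts c.toNat (Encodable.encode (seg Y s)) a := by
  simp only [oracleHalts, OracleCode.ofNat_toNat, toList_encode, OracleCode.eval_eq_evalP]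
  constructor
  · intro h
    obtain ⟨v, hv⟩ := Part.dom_iff_mem.1 h
    obtain ⟨s, hs⟩ := (OracleCode.evalP_eventually (l := Filter.atTop)
      (G := fun s n => (lookupPart (seg Y s) n : Part ℕ))
      (fun n v hv => eventually_mem_lookupPart_seg hv) c a v hv).exists
    exact ⟨s, Part.dom_iff_mem.2 ⟨v, hs⟩⟩
  · rintro ⟨s, h⟩
    obtain ⟨v, hv⟩ := Part.dom_iff_mem.1 h
    exact Part.dom_iff_mem.2 ⟨v, OracleCode.evalP_mono
      (fun n v hv => mem_charFn_of_mem_lookupPart (fun z hz => seg_subset_graphChi hz) hv) c hv⟩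

/-- With arbitrary finite oracles, correctness of the oracle is just a quantifier over the members
of a list. This is the form suited to counting quantifiers in `IsSigma0.of_ceIn`. -/
theorem dom_eval_iff_exists_list (Y : Set ℕ) (c : OracleCode) (a : ℕ) :
    (c.eval Y a).Dom ↔ ∃ σ, (∀ z ∈ toList σ, z ∈ graphChi Y) ∧ oracleHalts c.toNat σ a := by
  constructor
  · intro h
    obtain ⟨s, hs⟩ := (dom_eval_iff_exists_seg Y c a).1 h
    exact ⟨_, fun z hz => seg_subset_graphChi (by simpa using hz), hs⟩
  · rintro ⟨σ, hσ, h⟩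
    rw [oracleHalts, OracleCode.ofNat_toNat] at h
    obtain ⟨v, hv⟩ := Part.dom_iff_mem.1 h
    rw [OracleCode.eval_eq_evalP]
    exact Part.dom_iff_mem.2 ⟨v, OracleCode.evalP_mono
      (fun n v hv => mem_charFn_of_mem_lookupPart hσ hv) c hv⟩

/-! ### Functions recursive in a set, sets c.e. relative to a set -/

theorem OracleCode.recursiveIn_eval (Y : Set ℕ) (c : OracleCode) :
    Nat.RecursiveIn {charFn Y} (c.eval Y) := by
  induction c with
  | zero => exact .zero
  | succ => exact .succ
  | left => exact .left
  | right => exact .right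
  | oracle => exact .oracle _ rfl
  | pair _ _ h1 h2 => exact .pair h1 h2
  | comp _ _ h1 h2 => exact .comp h1 h2
  | prec _ _ h1 h2 => exact .prec h1 h2
  | rfind _ h => exact .rfind h

theorem OracleCode.exists_eval_eq {Y : Set ℕ} {f : ℕ →. ℕ} (hf : Nat.RecursiveIn {charFn Y} f) :
    ∃ c : OracleCode, c.eval Y = f := by
  induction hf with
  | zero => exact ⟨.zero, rfl⟩
  | succ => exact ⟨.succ, rfl⟩
  | left => exact ⟨.left, rfl⟩
  | right => exact ⟨.right, rfl⟩
  | oracle g hg => exact ⟨.oracle, by rw [Set.mem_singleton_iff.1 hg]; rfl⟩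
  | pair _ _ h1 h2 =>
    obtain ⟨⟨c, rfl⟩, ⟨d, rfl⟩⟩ := And.intro h1 h2
    exact ⟨.pair c d, rfl⟩
  | comp _ _ h1 h2 =>
    obtain ⟨⟨c, rfl⟩, ⟨d, rfl⟩⟩ := And.intro h1 h2
    exact ⟨.comp c d, rfl⟩
  | prec _ _ h1 h2 =>
    obtain ⟨⟨c, rfl⟩, ⟨d, rfl⟩⟩ := And.intro h1 h2
    exact ⟨.prec c d, rfl⟩
  | rfind _ h =>
    obtain ⟨c, rfl⟩ := h
    exact ⟨.rfind c, rfl⟩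

/-- `S` is c.e. relative to `Y`. -/
def CEIn (Y S : Set ℕ) : Prop := ∃ c : OracleCode, ∀ a, a ∈ S ↔ (c.eval Y a).Dom

theorem CEIn.of_recursiveIn {Y S : Set ℕ} {f : ℕ →. ℕ} (hf : Nat.RecursiveIn {charFn Y} f)
    (h : ∀ a, a ∈ S ↔ (f a).Dom) : CEIn Y S := by
  obtain ⟨c, rfl⟩ := OracleCode.exists_eval_eq hf
  exact ⟨c, h⟩

theorem CEIn.exists_relCE {Y S : Set ℕ} (h : CEIn Y S) : ∃ e, relCE Y e = S := by
  obtain ⟨c, hc⟩ := h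
  refine ⟨c.toNat, Set.ext fun a => ?_⟩
  rw [hc]
  exact ⟨fun ⟨d, hd, h⟩ => OracleCode.toNat_injective hd ▸ h, fun h => ⟨c, rfl, h⟩⟩

theorem CEIn.trans {X Y S : Set ℕ} (h : CEIn X S) (hXY : TuringLe X Y) : CEIn Y S := by
  obtain ⟨c, hc⟩ := h
  refine CEIn.of_recursiveIn ((c.recursiveIn_eval X).subst fun g hg => ?_) hc
  rw [Set.mem_singleton_iff.1 hg]
  exact RecursiveIn.iff_nat.1 hXY

/-- The total function `f` is computable relative to `Y`. -/
def RecTotal (Y : Set ℕ) (f : ℕ → ℕ) : Prop := Nat.RecursiveIn {charFn Y} fun n => Part.some (f n)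

namespace RecTotal
variable {Y : Set ℕ} {f g : ℕ → ℕ}

theorem of_computable (hf : Computable f) : RecTotal Y f :=
  Nat.Partrec.recursiveIn (Partrec.nat_iff.1 hf.partrec)

theorem chi (Y : Set ℕ) : RecTotal Y (chi Y) := Nat.RecursiveIn.oracle _ rfl

theorem comp (hf : RecTotal Y f) (hg : RecTotal Y g) : RecTotal Y fun n => f (g n) :=
  (Nat.RecursiveIn.comp hf hg).of_eq fun n => by simp

theorem pair (hf : RecTotal Y f) (hg : RecTotal Y g) : RecTotal Y fun n => Nat.pair (f n) (g n) :=
  (Nat.RecursiveIn.pair hf hg).of_eq fun n => by simp [Seq.seq]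

theorem natRec (a : ℕ) {h : ℕ → ℕ} (hh : RecTotal Y h) :
    RecTotal Y fun n => Nat.rec (motive := fun _ => ℕ) a (fun y ih => h (Nat.pair y ih)) n := by
  have h1 : RecTotal Y fun z => h z.unpair.2 :=
    hh.comp (of_computable (f := fun z => z.unpair.2) (by fun_prop))
  have h2 := Nat.RecursiveIn.prec (of_computable (Y := Y) (Computable.const a)) h1
  have h3 : Nat.RecursiveIn {charFn Y} fun n : ℕ => Part.some (Nat.pair 0 n) :=
    of_computable (f := fun n => Nat.pair 0 n) (by fun_prop)
  refine (Nat.RecursiveIn.comp h2 h3).of_eq fun n => ?_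
  simp only [Part.bind_eq_bind, Part.bind_some, Nat.unpair_pair]
  induction n with
  | zero => rfl
  | succ n ih => simp only [ih, Part.bind_some]

theorem encode_seg (Y : Set ℕ) : RecTotal Y fun s => Encodable.encode (seg Y s) := by
  -- The code of `a :: l` is the successor of the pair of `a` and the code of `l`; here `z` is `⟨s,
  -- code of seg Y s⟩`.
  have h : RecTotal Y fun z =>
      Nat.pair (Nat.pair z.unpair.1 (_root_.chi Y z.unpair.1)) z.unpair.2 + 1 := by
    have h0 : RecTotal Y fun z => z.unpair.1 := of_computable (by fun_prop)
    have h1 : RecTotal Y fun z => z.unpair.2 := of_computable (by fun_prop)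
    exact (of_computable (f := Nat.succ) Computable.succ).comp ((h0.pair ((chi Y).comp h0)).pair h1)
  have := natRec 0 h
  convert this using 2 with s
  induction s with
  | zero => rfl
  | succ s ih => simp [seg, ih]

end RecTotal

theorem CEIn.of_rfind {Y S : Set ℕ} {f : ℕ → ℕ} (hf : RecTotal Y f)
    (h : ∀ a, a ∈ S ↔ ∃ w, f (Nat.pair a w) = 0) : CEIn Y S := by
  refine CEIn.of_recursiveIn (Nat.RecursiveIn.rfind hf) fun a => ?_
  rw [h]
  refine Iff.trans ?_ Nat.rfind_dom'.symm
  simp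

/-- Sets defined from an initial segment of `Y` by a c.e. condition are c.e. relative to `Y`. -/
theorem CEIn.of_seg {Y : Set ℕ} {V : ℕ × ℕ → Prop} (hV : REPred V) :
    CEIn Y {a | ∃ s, V (a, Encodable.encode (seg Y s))} := by
  obtain ⟨q, hq, -, h⟩ := hV.exists_bool
  -- The argument is `⟨⟨a, ⟨s, n⟩⟩, σ⟩`, where `σ` codes the segment of length `s` and `n` is a
  -- stage in the enumeration of `V`. The value `0` signals success to the search.
  let F : ℕ → ℕ := fun z => bif q (z.unpair.1.unpair.1, z.unpair.2) z.unpair.1.unpair.2.unpair.2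
    then 0 else 1
  have hF : Computable F := by
    refine Computable.cond ?_ (Computable.const _) (Computable.const _)
    exact hq.comp (g := fun z : ℕ => ((z.unpair.1.unpair.1, z.unpair.2),
      z.unpair.1.unpair.2.unpair.2)) (by fun_prop)
  have h1 : RecTotal Y fun z => F (Nat.pair z (Encodable.encode (seg Y z.unpair.2.unpair.1))) :=
    (RecTotal.of_computable hF).comp ((RecTotal.of_computable Computable.id).pair
      ((RecTotal.encode_seg Y).comp (RecTotal.of_computable (f := fun z => z.unpair.2.unpair.1)
        (by fun_prop))))
  refine CEIn.of_rfind h1 fun a => ?_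
  simp only [Set.mem_ofPred_eq, h, F, Nat.unpair_pair]
  constructor
  · rintro ⟨s, n, hn⟩
    exact ⟨Nat.pair s n, by simp [hn]⟩
  · rintro ⟨w, hw⟩
    refine ⟨w.unpair.1, w.unpair.2, ?_⟩
    by_contra hc
    simp [Bool.not_eq_true _ ▸ hc] at hw

theorem CEIn.jump_self (Y : Set ℕ) : CEIn Y (jump Y) := by
  have h : REPred fun x : ℕ × ℕ => oracleHalts x.1 x.2 x.1 :=
    rePred_oracleHalts.comp (f := fun x : ℕ × ℕ => ((x.1, x.2), x.1)) (by fun_prop)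
  convert CEIn.of_seg (Y := Y) h using 1
  ext e
  simp only [jump, relCE, Set.mem_ofPred_eq]
  constructor
  · rintro ⟨c, rfl, h⟩
    exact (dom_eval_iff_exists_seg Y c _).1 h
  · intro h
    refine ⟨OracleCode.ofNat e, OracleCode.toNat_ofNat e, ?_⟩
    rwa [dom_eval_iff_exists_seg, OracleCode.toNat_ofNat]

/-- A long enough segment of `Y` records that `p` is absent. This is what makes both the conjunction
over primes outside `X` and the set `nonBase X` c.e. in `X`. -/
theorem CEIn.exists_notMem {Y : Set ℕ} {Q : ℕ × ℕ → Prop} (hQ : REPred Q) :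
    CEIn Y {a | ∃ p ∉ Y, Q (a, p)} := by
  have h1 : REPred fun x : (ℕ × ℕ) × ℕ => Nat.pair x.2 0 ∈ toList x.1.2 ∧ Q (x.1.1, x.2) :=
    (computable_list_mem.comp (f := fun x : (ℕ × ℕ) × ℕ => (Nat.pair x.2 0, toList x.1.2))
      (by fun_prop)).to_re.and (hQ.comp (f := fun x : (ℕ × ℕ) × ℕ => (x.1.1, x.2)) (by fun_prop))
  convert CEIn.of_seg (Y := Y) h1.exists_nat using 1
  ext a
  simp only [Set.mem_ofPred_eq, toList_encode, mem_seg]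
  constructor
  · rintro ⟨p, hp, h⟩
    exact ⟨p + 1, p, ⟨p, by omega, by rw [chi_of_notMem hp]⟩, h⟩
  · rintro ⟨s, p, ⟨i, -, h⟩, hQ⟩
    obtain ⟨rfl, h2⟩ := Nat.pair_eq_pair.1 h
    exact ⟨p, chi_eq_zero_iff.1 h2.symm, hQ⟩

theorem CEIn.of_rePred {Y : Set ℕ} {S : Set ℕ} (hS : REPred fun a => a ∈ S) : CEIn Y S := by
  convert CEIn.of_seg (Y := Y) (hS.comp (f := fun x : ℕ × ℕ => x.1) (by fun_prop)) using 1
  simp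

namespace OracleCode

/-- A program for a constant function. -/
def const : ℕ → OracleCode
  | 0 => zero
  | n + 1 => comp succ (const n)

theorem eval_const (Y : Set ℕ) (n m : ℕ) : (const n).eval Y m = Part.some n := by
  induction n with
  | zero => rfl
  | succ n ih => simp [const, eval, ih]

theorem computable_toNat_const : Computable fun n => (const n).toNat := by
  have : Computable fun n : ℕ => Nat.rec (motive := fun _ => ℕ) 0
      (fun _ ih => 4 * Nat.pair 1 ih + 6) n :=
    Computable.nat_rec (h := fun _ x => 4 * Nat.pair 1 x.2 + 6) Computable.id (Computable.const 0)
      (show Computable fun x : ℕ × (ℕ × ℕ) => 4 * Nat.pair 1 x.2.2 + 6 by fun_prop)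
  refine this.of_eq fun n => ?_
  induction n with
  | zero => rfl
  | succ n ih => simp only [const, toNat, ih]

end OracleCode

/-- Composing the enumerating program with a constant program for `a` gives a program that ignores
its input. It halts on its own number exactly when the original halts on `a`, and its number is
computable from `a`. -/
theorem CEIn.exists_reduction {Y S : Set ℕ} (h : CEIn Y S) :
    ∃ f : ℕ → ℕ, Computable f ∧ ∀ a, a ∈ S ↔ f a ∈ jump Y := by
  obtain ⟨c, hc⟩ := h
  have hcomp : Computable fun a => 4 * Nat.pair c.toNat (OracleCode.const a).toNat + 6 := by
    have := OracleCode.computable_toNat_const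
    fun_prop
  refine ⟨fun a => (OracleCode.comp c (.const a)).toNat, hcomp, fun a => ?_⟩
  rw [hc]
  have key : ∀ m, (OracleCode.comp c (.const a)).eval Y m = c.eval Y a := fun m => by
    simp only [OracleCode.eval, OracleCode.eval_const]
    exact Part.bind_some _ _
  constructor
  · intro h
    exact ⟨_, rfl, by rwa [key]⟩
  · rintro ⟨d, hd, h⟩
    rwa [OracleCode.toNat_injective hd, key] at h

theorem turingLe_of_recTotal {A B : Set ℕ} (h : RecTotal B (chi A)) : TuringLe A B :=
  RecursiveIn.iff_nat.2 h

theorem turingLe_of_reduction {A B : Set ℕ} {f : ℕ → ℕ} (hf : Computable f)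
    (h : ∀ a, a ∈ A ↔ f a ∈ B) : TuringLe A B := by
  refine turingLe_of_recTotal ?_
  convert (RecTotal.chi B).comp (.of_computable hf) using 2 with a
  by_cases ha : a ∈ A
  · rw [chi_of_mem ha, chi_of_mem ((h a).1 ha)]
  · rw [chi_of_notMem ha, chi_of_notMem (mt (h a).2 ha)]

theorem CEIn.turingLe_jump {Y S : Set ℕ} (h : CEIn Y S) : TuringLe S (jump Y) := by
  obtain ⟨f, hf, h⟩ := h.exists_reduction
  exact turingLe_of_reduction hf h

theorem TuringLe.jump {A B : Set ℕ} (h : TuringLe A B) : TuringLe (jump A) (jump B) :=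
  ((CEIn.jump_self A).trans h).turingLe_jump

/-! ### Closure properties of the arithmetical hierarchy -/

namespace IsSigma0
variable {n : ℕ} {S T : Set ℕ}

theorem comp {f : ℕ → ℕ} (h : IsSigma0 n S) (hf : Computable f) :
    IsSigma0 n {a | f a ∈ S} := by
  induction n generalizing S f with
  | zero => exact ComputablePred.comp (p := fun a => a ∈ S) h hf
  | succ n ih =>
    obtain ⟨R, hR, h⟩ := h
    refine ⟨_, ih (f := fun z => Nat.pair (f z.unpair.1) z.unpair.2) hR (by fun_prop), fun a => ?_⟩
    simp [h]

theorem compl_succ (h : IsSigma0 n S) : IsSigma0 (n + 1) Sᶜ :=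
  ⟨_, h.comp (f := fun z => z.unpair.1) (by fun_prop), fun a => by simp⟩

theorem succ (h : IsSigma0 n S) : IsSigma0 (n + 1) S := by
  induction n generalizing S with
  | zero =>
    have : IsSigma0 0 Sᶜ := ComputablePred.not h
    simpa using this.compl_succ
  | succ n ih =>
    obtain ⟨R, hR, h⟩ := h
    exact ⟨R, ih hR, h⟩

theorem mono {m : ℕ} (h : IsSigma0 n S) (hm : n ≤ m) : IsSigma0 m S := by
  induction m, hm using Nat.le_induction with
  | base => exact h
  | succ m _ ih => exact ih.succ

/-- The two closure properties need a joint induction: the matrix of a `Σ⁰_{n+1}` set is the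
complement of a `Σ⁰_n` set, so intersection at one level uses union at the level below, and
conversely. -/
theorem inter_and_union (n : ℕ) : ∀ S T, IsSigma0 n S → IsSigma0 n T →
    IsSigma0 n (S ∩ T) ∧ IsSigma0 n (S ∪ T) := by
  induction n with
  | zero => exact fun S T hS hT => ⟨ComputablePred.and hS hT, ComputablePred.or hS hT⟩
  | succ n ih =>
    rintro S T ⟨R, hR, hS⟩ ⟨Q, hQ, hT⟩
    constructor
    · refine ⟨_, (ih _ _
        (hR.comp (f := fun z => Nat.pair z.unpair.1 z.unpair.2.unpair.1) (by fun_prop))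
        (hQ.comp (f := fun z => Nat.pair z.unpair.1 z.unpair.2.unpair.2) (by fun_prop))).2,
        fun a => ?_⟩
      simp only [Set.mem_inter_iff, hS, hT, Set.mem_compl_iff, Set.mem_union, Set.mem_ofPred_eq,
        Nat.unpair_pair, not_or]
      exact ⟨fun ⟨⟨x, hx⟩, y, hy⟩ => ⟨Nat.pair x y, by simpa using hx, by simpa using hy⟩,
        fun ⟨x, h1, h2⟩ => ⟨⟨_, h1⟩, _, h2⟩⟩
    · refine ⟨_, (ih _ _ hR hQ).1, fun a => ?_⟩
      simp only [Set.mem_union, hS, hT, Set.mem_compl_iff, Set.mem_inter_iff, not_and_or, exists_or]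

theorem inter (hS : IsSigma0 n S) (hT : IsSigma0 n T) : IsSigma0 n (S ∩ T) :=
  (inter_and_union n S T hS hT).1

theorem union (hS : IsSigma0 n S) (hT : IsSigma0 n T) : IsSigma0 n (S ∪ T) :=
  (inter_and_union n S T hS hT).2

theorem exists_nat (h : IsSigma0 (n + 1) T) : IsSigma0 (n + 1) {a | ∃ x, Nat.pair a x ∈ T} := by
  obtain ⟨R, hR, h⟩ := h
  refine ⟨_, hR.comp (f := fun z => Nat.pair (Nat.pair z.unpair.1 z.unpair.2.unpair.1)
    z.unpair.2.unpair.2) (by fun_prop), fun a => ?_⟩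
  simp only [Set.mem_ofPred_eq, h, Set.mem_compl_iff, Nat.unpair_pair]
  exact ⟨fun ⟨x, y, h⟩ => ⟨Nat.pair x y, by simpa using h⟩, fun ⟨x, h⟩ => ⟨_, _, h⟩⟩

theorem of_computablePred (h : ComputablePred fun a => a ∈ S) : IsSigma0 n S :=
  mono (n := 0) h (Nat.zero_le n)

theorem of_rePred (h : REPred fun a => a ∈ S) : IsSigma0 (n + 1) S := by
  obtain ⟨f, hf, -, h⟩ := h.exists_bool
  have h1 : IsSigma0 0 {z : ℕ | ¬ f z.unpair.1 z.unpair.2 = true} :=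
    (Computable.computablePred_of_bool (f := fun z : ℕ => f z.unpair.1 z.unpair.2)
      (hf.comp Computable.unpair) fun _ => Iff.rfl).not
  exact mono (n := 1) ⟨_, h1, fun a => by simp [h]⟩ (by omega)

theorem rePred (h : IsSigma0 1 S) : REPred fun a => a ∈ S := by
  obtain ⟨R, hR, h⟩ := h
  refine (REPred.exists_nat ((ComputablePred.not hR).comp
    (f := fun x : ℕ × ℕ => Nat.pair x.1 x.2) (by fun_prop)).to_re).of_eq fun a => ?_
  rw [h]; rfl

/-- Above level zero the list quantifier is absorbed into the leading existential one. At level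
zero, both the set and its complement are c.e. -/
theorem exists_mem_list (h : IsSigma0 n S) : IsSigma0 n {l | ∃ z ∈ toList l, z ∈ S} := by
  have hmem : ComputablePred fun z : ℕ => z.unpair.2 ∈ toList z.unpair.1 :=
    computable_list_mem.comp (f := fun z : ℕ => (z.unpair.2, toList z.unpair.1)) (by fun_prop)
  have hsucc : ∀ n S, IsSigma0 (n + 1) S → IsSigma0 (n + 1) {l | ∃ z ∈ toList l, z ∈ S} :=
    fun n S h => by
      convert exists_nat ((of_computablePred (S := {z : ℕ | z.unpair.2 ∈ toList z.unpair.1})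
        hmem).inter (h.comp (f := fun z => z.unpair.2) (by fun_prop))) using 1
      ext l
      simp
  cases n with
  | succ n => exact hsucc n S h
  | zero =>
    have hc : IsSigma0 0 Sᶜ := ComputablePred.not h
    refine ComputablePred.computable_iff_re_compl_re'.2 ⟨(hsucc 0 S h.succ).rePred, ?_⟩
    refine ((REPred.forall_mem_list (hc.succ.rePred)).comp (f := toList) (by fun_prop)).of_eq ?_
    intro l
    simp

theorem forall_mem_list (h : IsSigma0 (n + 1) S) :
    IsSigma0 (n + 1) {l | ∀ z ∈ toList l, z ∈ S} := by
  obtain ⟨R, hR, h⟩ := h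
  have hmap : Computable fun l : ℕ => Encodable.encode ((toList l).map fun z => z.unpair.1) := by
    have : Primrec fun l : List ℕ => l.map fun z => z.unpair.1 :=
      Primrec.list_map Primrec.id (Primrec.fst.comp (Primrec.unpair.comp Primrec.snd))
    exact Computable.encode.comp (this.to_comp.comp (computable_toList Computable.id))
  have h1 : ComputablePred fun z : ℕ =>
      ¬ Encodable.encode ((toList z.unpair.2).map fun z => z.unpair.1) = z.unpair.1 :=
    (ComputablePred.natEq (hmap.comp (g := fun z : ℕ => z.unpair.2) (by fun_prop))
      (by fun_prop)).not
  -- The witnesses for all members of the list are collected in one list of pairs `⟨z, witness⟩`,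
  -- which must project to the given list and contain no pair in `R`.
  refine ⟨_, (of_computablePred (S := {z : ℕ |
      ¬ Encodable.encode ((toList z.unpair.2).map fun z => z.unpair.1) = z.unpair.1}) h1).union
    (hR.exists_mem_list.comp (f := fun z => z.unpair.2) (by fun_prop)), fun l => ?_⟩
  simp only [Set.mem_ofPred_eq, Set.mem_compl_iff, Set.mem_union, Nat.unpair_pair, not_or, not_not]
  have hl : l = Encodable.encode (toList l) := (Denumerable.encode_ofNat l).symm
  constructor
  · intro H
    choose! g hg using fun z (hz : z ∈ toList l) => (h z).1 (H z hz)
    refine ⟨Encodable.encode ((toList l).map fun z => Nat.pair z (g z)), ?_, ?_⟩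
    · conv_rhs => rw [hl]
      simp [Function.comp_def]
    · rintro ⟨w, hw, hwR⟩
      simp only [toList_encode, List.mem_map] at hw
      obtain ⟨z, hz, rfl⟩ := hw
      exact hg z hz hwR
  · rintro ⟨M, hM, hR⟩ z hz
    rw [← hM, toList_encode, List.mem_map] at hz
    obtain ⟨w, hw, rfl⟩ := hz
    exact (h _).2 ⟨w.unpair.2, fun hc => hR ⟨w, hw, by simpa using hc⟩⟩

/-- The graph combines `S` and its complement, which costs one level. -/
theorem graphChi (h : IsSigma0 n S) : IsSigma0 (n + 1) (graphChi S) := by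
  have h1 : ∀ k, IsSigma0 (n + 1) {z : ℕ | z.unpair.2 = k} := fun k =>
    of_computablePred (ComputablePred.natEq (by fun_prop) (by fun_prop))
  convert (((h.comp (f := fun z => z.unpair.1) (by fun_prop)).succ).inter (h1 1)).union
    (((h.comp (f := fun z => z.unpair.1) (by fun_prop)).compl_succ).inter (h1 0)) using 1
  ext z
  by_cases hz : z.unpair.1 ∈ S <;> simp [_root_.graphChi, chi, hz]

/-- A set c.e. relative to a `Σ⁰_n` set is `Σ⁰_{n+1}`. -/
theorem of_ceIn {Y : Set ℕ} (hY : IsSigma0 n Y) (h : CEIn Y S) : IsSigma0 (n + 1) S := by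
  obtain ⟨c, hc⟩ := h
  have h1 : IsSigma0 (n + 1) {z : ℕ | oracleHalts c.toNat z.unpair.2 z.unpair.1} :=
    of_rePred (rePred_oracleHalts.comp (f := fun z : ℕ => ((c.toNat, z.unpair.2), z.unpair.1))
      (by fun_prop))
  convert exists_nat
    ((hY.graphChi.forall_mem_list.comp (f := fun z => z.unpair.2) (by fun_prop)).inter h1) using 1
  ext a
  simp [hc, dom_eval_iff_exists_list]

theorem jump (h : IsSigma0 n S) : IsSigma0 (n + 1) (jump S) := h.of_ceIn (CEIn.jump_self S)

theorem empty : IsSigma0 n ∅ :=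
  of_computablePred (Computable.computablePred_of_bool (Computable.const false) (by simp))

end IsSigma0

/-! ### Rank one torsion-free abelian groups -/

section RankOne
variable {A : Type} [AddCommGroup A] {X : Set ℕ}

theorem zsmul_eq_zero_of_torsionFree (tf : ∀ (k : ℕ) (x : A), (k + 1) • x = 0 → x = 0)
    {k : ℤ} (hk : k ≠ 0) {x : A} (h : k • x = 0) : x = 0 := by
  obtain ⟨m, hm⟩ : ∃ m : ℕ, k.natAbs = m + 1 := ⟨k.natAbs - 1, by omega⟩
  refine tf m x ?_
  rw [← hm, ← natCast_zsmul, Int.natCast_natAbs]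
  rcases abs_choice k with h' | h' <;> rw [h']
  · exact h
  · rw [neg_zsmul, h, neg_zero]

theorem exists_nsmul_eq_of_primeFactors (div : ∀ p ∈ X, ∀ x : A, ∃ y : A, p • y = x) (d : ℕ)
    (hd : d ≠ 0) (h : ∀ p : ℕ, p.Prime → p ∣ d → p ∈ X) (x : A) : ∃ y : A, d • y = x := by
  induction d using induction_on_primes generalizing x with
  | zero => exact absurd rfl hd
  | one => exact ⟨x, one_nsmul x⟩
  | prime_mul p a hp ih =>
    obtain ⟨z, rfl⟩ := div p (h p hp ⟨a, rfl⟩) x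
    obtain ⟨y, rfl⟩ := ih (by rintro rfl; simp at hd)
      (fun q hq hqa => h q hq (hqa.mul_left p)) z
    exact ⟨y, mul_nsmul' y p a⟩

/-- The map sends `a` to `z / m` for any relation `m • a = z • u` with `m ≠ 0`. Rank one provides
such a relation; torsion-freeness makes the ratio well defined and the map injective. Divisibility
by `X` puts every admissible denominator in the range, and the base property of `u` excludes the
others. -/
theorem exists_hom_rat (tf : ∀ (k : ℕ) (x : A), (k + 1) • x = 0 → x = 0)
    (rank : ∀ x y : A, y = 0 ∨ ∃ m n : ℕ, (m + 1) • x = n • y ∨ (m + 1) • x + n • y = 0)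
    (div : ∀ p ∈ X, ∀ x : A, ∃ y : A, p • y = x) {u : A} (hu : u ≠ 0)
    (base : ∀ p : ℕ, p.Prime → p ∉ X → ∀ y : A, p • y ≠ u) :
    ∃ q : A →+ ℚ, Function.Injective q ∧
      ∀ r : ℚ, r ∈ q.range ↔ ∀ p : ℕ, p.Prime → p ∣ r.den → p ∈ X := by
  have tfz : ∀ {k : ℤ} {x : A}, k ≠ 0 → k • x = 0 → x = 0 := fun hk =>
    zsmul_eq_zero_of_torsionFree tf hk
  have tfu : ∀ {k : ℤ}, k • u = 0 → k = 0 := fun h => by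
    by_contra hk; exact hu (tfz hk h)
  have hex : ∀ a : A, ∃ m z : ℤ, m ≠ 0 ∧ m • a = z • u := by
    intro a
    obtain h | ⟨m, n, h | h⟩ := rank a u
    · exact absurd h hu
    · exact ⟨m + 1, n, by omega, by rw [natCast_zsmul, ← h]; exact_mod_cast natCast_zsmul a (m + 1)⟩
    · refine ⟨m + 1, -n, by omega, ?_⟩
      rw [neg_zsmul, natCast_zsmul, ← eq_neg_of_add_eq_zero_left h]
      exact_mod_cast natCast_zsmul a (m + 1)
  choose M Z hM hMZ using hex
  -- The fraction does not depend on the chosen relation; additivity and the computation of the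
  -- range both rest on this.
  have key : ∀ (a : A) (m z : ℤ), m ≠ 0 → m • a = z • u → (Z a : ℚ) / M a = z / m := by
    intro a m z hm h
    have : (m * Z a - M a * z) • u = 0 := by
      rw [sub_zsmul, mul_zsmul, mul_zsmul, ← hMZ, ← h, ← mul_zsmul, ← mul_zsmul, mul_comm,
        add_neg_cancel]
    have h2 : m * Z a = M a * z := sub_eq_zero.1 (tfu this)
    have hm' : (m : ℚ) ≠ 0 := by exact_mod_cast hm
    have hM' : (M a : ℚ) ≠ 0 := by exact_mod_cast hM a
    rw [div_eq_div_iff hM' hm']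
    have h3 : (m : ℚ) * Z a = M a * z := by exact_mod_cast h2
    linarith
  let q : A →+ ℚ := AddMonoidHom.mk' (fun a => (Z a : ℚ) / M a) (by
    intro a b
    have hMa : (M a : ℚ) ≠ 0 := by exact_mod_cast hM a
    have hMb : (M b : ℚ) ≠ 0 := by exact_mod_cast hM b
    rw [key (a + b) (M a * M b) (Z a * M b + Z b * M a) (mul_ne_zero (hM a) (hM b))]
    · push_cast; field_simp
    · rw [zsmul_add, add_zsmul, mul_comm (M a), mul_zsmul, hMZ a, mul_comm (M b), mul_zsmul, hMZ b,
        ← mul_zsmul, ← mul_zsmul, mul_comm (M b), mul_comm (M a)])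
  have hq : ∀ a, q a = (Z a : ℚ) / M a := fun _ => rfl
  refine ⟨q, (injective_iff_map_eq_zero q).2 fun a ha => ?_, fun r => ⟨?_, fun h => ?_⟩⟩
  · have hMa : (M a : ℚ) ≠ 0 := by exact_mod_cast hM a
    rw [hq, div_eq_zero_iff, or_iff_left hMa] at ha
    have : Z a = 0 := by exact_mod_cast ha
    exact tfz (hM a) (by rw [hMZ, this, zero_zsmul])
  · rintro ⟨a, ha⟩ p hp ⟨d, hd⟩
    by_contra hpX
    have hMa : (M a : ℚ) ≠ 0 := by exact_mod_cast hM a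
    have hr : (Z a : ℤ) * r.den = r.num * M a := by
      have h1 : (Z a : ℚ) / M a = r.num / r.den := by rw [← hq, ha, Rat.num_div_den]
      rw [div_eq_div_iff hMa (by exact_mod_cast r.den_nz)] at h1
      exact_mod_cast h1
    -- The relation between rationals pulls back to `A` after cancelling the factor `M a`, by
    -- torsion-freeness.
    have h1 : (r.den : ℤ) • a = r.num • u := by
      refine sub_eq_zero.1 (tfz (hM a) ?_)
      rw [zsmul_sub, ← mul_zsmul, mul_comm, mul_zsmul, hMZ, ← mul_zsmul, ← mul_zsmul,
        mul_comm (M a), ← hr, mul_comm, sub_self]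
    have hcop : IsCoprime (p : ℤ) r.num := by
      have h2 : IsCoprime (r.den : ℤ) r.num := (Rat.isCoprime_num_den r).symm
      rw [hd] at h2
      push_cast at h2
      exact h2.of_mul_left_left
    obtain ⟨s, t, hst⟩ := hcop
    -- From `s * p + t * r.num = 1` and `r.den = p * d`, multiplying this element by `p` gives `(s *
    -- p + t * r.num) • u = u`, against the choice of `u`.
    refine base p hp hpX (s • u + (t * d) • a) ?_
    rw [← natCast_zsmul, zsmul_add, ← mul_zsmul, ← mul_zsmul]
    have h2 : (p * (t * d) : ℤ) • a = (t * r.num) • u := by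
      rw [mul_zsmul u, ← h1, ← mul_zsmul, hd]
      congr 1; push_cast; ring
    rw [h2, ← add_zsmul, mul_comm, hst, one_zsmul]
  · obtain ⟨y, hy⟩ := exists_nsmul_eq_of_primeFactors div r.den r.den_nz h u
    refine ⟨r.num • y, ?_⟩
    rw [hq, key _ r.den r.num (by exact_mod_cast r.den_nz), Int.cast_natCast, Rat.num_div_den]
    rw [← mul_zsmul, mul_comm, mul_zsmul, natCast_zsmul, hy]

end RankOne

/-! ### Structures for the language of groups -/

section Structures
open FirstOrder FirstOrder.Language
variable {M N : Type} [groupLang.Structure M] [groupLang.Structure N]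

/-- The interpretation of the identity symbol. -/
def gOne : M := Structure.funMap (L := groupLang) GroupFunc.one ![]
/-- The interpretation of the inverse symbol. -/
def gInv (x : M) : M := Structure.funMap (L := groupLang) GroupFunc.inv ![x]
/-- The interpretation of the group operation symbol. -/
def gMul (x y : M) : M := Structure.funMap (L := groupLang) GroupFunc.mul ![x, y]
/-- Iterated products. -/
def gPow : ℕ → M → M
  | 0, _ => gOne
  | k + 1, x => gMul (gPow k x) x

theorem funMap_one (x : Fin 0 → M) : Structure.funMap (L := groupLang) GroupFunc.one x = gOne := by
  rw [gOne]; congr 1; exact Subsingleton.elim _ _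
theorem funMap_inv (x : Fin 1 → M) :
    Structure.funMap (L := groupLang) GroupFunc.inv x = gInv (x 0) := by
  rw [gInv]; congr 1; ext i; fin_cases i; rfl
theorem funMap_mul (x : Fin 2 → M) :
    Structure.funMap (L := groupLang) GroupFunc.mul x = gMul (x 0) (x 1) := by
  rw [gMul]; congr 1; ext i; fin_cases i <;> rfl

theorem equiv_gOne (e : groupLang.Equiv M N) : e gOne = gOne :=
  (e.map_fun (GroupFunc.one : groupLang.Functions 0) _).trans (funMap_one _)
theorem equiv_gInv (e : groupLang.Equiv M N) (x : M) : e (gInv x) = gInv (e x) :=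
  (e.map_fun (GroupFunc.inv : groupLang.Functions 1) _).trans (funMap_inv _)
theorem equiv_gMul (e : groupLang.Equiv M N) (x y : M) : e (gMul x y) = gMul (e x) (e y) :=
  (e.map_fun (GroupFunc.mul : groupLang.Functions 2) _).trans (funMap_mul _)
theorem equiv_gPow (e : groupLang.Equiv M N) (k : ℕ) (x : M) : e (gPow k x) = gPow k (e x) := by
  induction k with
  | zero => exact equiv_gOne e
  | succ k ih => rw [gPow, equiv_gMul, ih, gPow]

/-- A bijection that respects the operations is an isomorphism. -/
def equivOfOps (e : M ≃ N) (h1 : e gOne = gOne) (hi : ∀ x, e (gInv x) = gInv (e x))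
    (hm : ∀ x y, e (gMul x y) = gMul (e x) (e y)) : groupLang.Equiv M N where
  toEquiv := e
  map_fun' {n} f x := by
    change GroupFunc n at f
    cases f
    · exact (congrArg e (funMap_one x)).trans (h1.trans (funMap_one _).symm)
    · exact (congrArg e (funMap_inv x)).trans ((hi _).trans (funMap_inv (e ∘ x)).symm)
    · exact (congrArg e (funMap_mul x)).trans ((hm _ _).trans (funMap_mul (e ∘ x)).symm)
  map_rel' {n} r := Empty.elim r

variable (X : Set ℕ)

/-- Torsion-free abelian groups of rank at most one all of whose elements are divisible by all
elements of `X`. -/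
structure IsRankOneDivisible (M : Type) [groupLang.Structure M] : Prop where
  assoc : ∀ x y z : M, gMul (gMul x y) z = gMul x (gMul y z)
  comm : ∀ x y : M, gMul x y = gMul y x
  one_mul : ∀ x : M, gMul gOne x = x
  inv_mul : ∀ x : M, gMul (gInv x) x = gOne
  torsionFree : ∀ (k : ℕ) (x : M), gPow (k + 1) x = gOne → x = gOne
  rank : ∀ x y : M, y = gOne ∨
    ∃ m n : ℕ, gPow (m + 1) x = gPow n y ∨ gMul (gPow (m + 1) x) (gPow n y) = gOne
  div : ∀ p ∈ X, ∀ x : M, ∃ y : M, gPow p y = x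

/-- There is a nontrivial element that is not divisible by any prime outside `X`. -/
def HasBase (M : Type) [groupLang.Structure M] : Prop :=
  ∃ u : M, ∀ p ∉ X, p = 0 ∨ p.Prime → ∀ y : M, gPow p y ≠ u

variable {X}

theorem IsRankOneDivisible.of_equiv (e : groupLang.Equiv M N) (h : IsRankOneDivisible X N) :
    IsRankOneDivisible X M where
  assoc x y z := e.injective (by simp only [equiv_gMul, h.assoc])
  comm x y := e.injective (by simp only [equiv_gMul, h.comm (e x)])
  one_mul x := e.injective (by simp only [equiv_gMul, equiv_gOne, h.one_mul])
  inv_mul x := e.injective (by simp only [equiv_gMul, equiv_gInv, equiv_gOne, h.inv_mul])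
  torsionFree k x hx := e.injective (by
    rw [equiv_gOne]; exact h.torsionFree k _ (by rw [← equiv_gPow, hx, equiv_gOne]))
  rank x y := by
    refine (h.rank (e x) (e y)).imp (fun H => e.injective (by rw [H, equiv_gOne])) ?_
    rintro ⟨m, n, H⟩
    exact ⟨m, n, H.imp (fun H => e.injective (by simp only [equiv_gPow, H]))
      (fun H => e.injective (by simp only [equiv_gMul, equiv_gPow, equiv_gOne, H]))⟩
  div p hp x := by
    obtain ⟨y, hy⟩ := h.div p hp (e x)
    obtain ⟨y, rfl⟩ := e.surjective y
    exact ⟨y, e.injective (by rw [equiv_gPow, hy])⟩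

theorem HasBase.of_equiv (e : groupLang.Equiv M N) (h : HasBase X N) : HasBase X M := by
  obtain ⟨u, hu⟩ := h
  obtain ⟨u, rfl⟩ := e.surjective u
  exact ⟨u, fun p hp hpp y hy => hu p hp hpp (e y) (by rw [← equiv_gPow, hy])⟩

/-- The abelian group given by a structure that satisfies the axioms. -/
@[reducible] def IsRankOneDivisible.addCommGroup (h : IsRankOneDivisible X M) : AddCommGroup M :=
  letI : Add M := ⟨gMul⟩
  letI : Zero M := ⟨gOne⟩
  letI : Neg M := ⟨gInv⟩
  { AddGroup.ofLeftAxioms h.assoc h.one_mul h.inv_mul with add_comm := h.comm }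

theorem IsRankOneDivisible.exists_hom (h : IsRankOneDivisible X M) (hb : HasBase X M)
    (h0 : 0 ∉ X) : letI := h.addCommGroup
    ∃ q : M →+ ℚ, Function.Injective q ∧
      ∀ r : ℚ, r ∈ q.range ↔ ∀ p : ℕ, p.Prime → p ∣ r.den → p ∈ X := by
  let := h.addCommGroup
  have hpow : ∀ (k : ℕ) (x : M), gPow k x = k • x := fun k x => by
    induction k with
    | zero => exact (zero_nsmul x).symm
    | succ k ih => rw [gPow, ih, succ_nsmul]; rfl
  obtain ⟨u, hu⟩ := hb
  refine exists_hom_rat (u := u) (fun k x hx => h.torsionFree k x ?_) (fun x y => ?_)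
    (fun p hp x => ?_) (fun hu0 => ?_) (fun p hp hpX y => ?_)
  · rw [hpow]; exact hx
  · have := h.rank x y
    simp only [hpow] at this
    exact this
  · obtain ⟨y, hy⟩ := h.div p hp x
    exact ⟨y, by rw [← hpow, hy]⟩
  -- The zeroth power of any element is the identity, so the clause `p = 0` of `HasBase` expresses
  -- nontriviality; it is available because `0 ∉ X`.
  · exact hu 0 h0 (Or.inl rfl) u hu0.symm
  · rw [← hpow]; exact hu p hpX (Or.inr hp) y

/-- Both groups embed in `ℚ` with the same image, since the image is described by `X` alone. -/
theorem IsRankOneDivisible.nonempty_equiv (hM : IsRankOneDivisible X M) (hMb : HasBase X M)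
    (hN : IsRankOneDivisible X N) (hNb : HasBase X N) (h0 : 0 ∉ X) :
    Nonempty (groupLang.Equiv M N) := by
  let := hM.addCommGroup
  let := hN.addCommGroup
  obtain ⟨q, hq, hqr⟩ := hM.exists_hom hMb h0
  obtain ⟨r, hr, hrr⟩ := hN.exists_hom hNb h0
  have heq : q.range = r.range := by ext x; rw [hqr, hrr]
  let e : M ≃+ N := (AddMonoidHom.ofInjective hq).trans
    ((AddEquiv.addSubgroupCongr heq).trans (AddMonoidHom.ofInjective hr).symm)
  exact ⟨equivOfOps e.toEquiv (map_zero e) (map_neg e) (map_add e)⟩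

end Structures

/-! ### Subgroups of the rationals -/

section Rational
variable {G : AddSubgroup ℚ} {u : G} {X : Set ℕ}

theorem gPow_eq_nsmul {A : Type} [AddGroup A] (k : ℕ) (x : A) : gPow k x = k • x := by
  induction k with
  | zero => exact (zero_nsmul x).symm
  | succ k ih => rw [gPow, ih, succ_nsmul]; rfl

/-- If divisibility by powers of `p` stopped at some positive exponent, that exponent would put `p`
in `primesFin u`. -/
theorem mem_primesInf_iff (hfin : primesFin u = ∅) (p : ℕ) :
    p ∈ primesInf u ↔ p.Prime ∧ ∃ y : G, p • y = u := by
  constructor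
  · rintro ⟨hp, h⟩
    exact ⟨hp, by simpa using h 1 one_pos⟩
  · rintro ⟨hp, h⟩
    refine ⟨hp, fun k hk => ?_⟩
    induction k, hk using Nat.le_induction with
    | base => simpa using h
    | succ k hk ih =>
      by_contra hc
      have : p ∈ primesFin u := ⟨hp, k, hk, ih, hc⟩
      simp [hfin] at this

theorem hasBase_of_primes (hu : u ≠ 0) (hfin : primesFin u = ∅) (hinf : primesInf u = X) :
    HasBase X G := by
  refine ⟨u, ?_⟩
  rintro p hp (rfl | hpp) y hy
  · exact hu (by rw [← hy]; rfl)
  · rw [gPow_eq_nsmul] at hy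
    exact hp (hinf ▸ (mem_primesInf_iff hfin p).2 ⟨hpp, y, hy⟩)

theorem isRankOneDivisible_of_primes (hu : u ≠ 0) (hinf : primesInf u = X) :
    IsRankOneDivisible X G where
  assoc := add_assoc
  comm := add_comm
  one_mul := zero_add
  inv_mul := neg_add_cancel
  torsionFree k x hx := by
    rw [gPow_eq_nsmul] at hx
    exact (smul_eq_zero.1 hx).resolve_left (by omega)
  rank x y := by
    simp only [gPow_eq_nsmul]
    by_cases hy : y = 0
    · exact Or.inl hy
    right
    have hy' : (y : ℚ) ≠ 0 := by simpa using hy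
    set r : ℚ := x / y with hr
    have h1 : (r.den : ℚ) * x = r.num * y := by
      have h2 : (r.num : ℚ) = r * r.den := (Rat.mul_den_eq_num r).symm
      rw [h2, hr]; field_simp
    have hden : r.den - 1 + 1 = r.den := Nat.sub_add_cancel r.den_pos
    -- The relation is `r.den * x = r.num * y` with `r = x / y`; the axiom uses `m + 1` as the
    -- coefficient, and the sign of `r.num` selects the alternative.
    refine ⟨r.den - 1, r.num.natAbs, ?_⟩
    rw [hden]
    rcases Int.natAbs_eq r.num with h | h
    · left
      ext
      rw [h] at h1
      push_cast at h1
      simpa using h1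
    · right
      ext
      rw [h] at h1
      push_cast at h1
      change ((r.den • x + r.num.natAbs • y : G) : ℚ) = 0
      push_cast
      simp only [nsmul_eq_mul]
      rw [Nat.cast_natAbs]
      push_cast
      linarith
  div p hp x := by
    simp only [gPow_eq_nsmul]
    rw [← hinf] at hp
    obtain ⟨hpp, hdiv⟩ := hp
    have hu' : (u : ℚ) ≠ 0 := by simpa using hu
    have hp0 : (p : ℚ) ≠ 0 := by exact_mod_cast hpp.ne_zero
    set r : ℚ := x / u with hr
    obtain ⟨j, d, hd, hjd⟩ := Nat.exists_eq_pow_mul_and_not_dvd r.den_nz p hpp.ne_one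
    obtain ⟨v, hv⟩ := hdiv (j + 1) (Nat.succ_pos j)
    have hcop : IsCoprime ((p ^ (j + 1) : ℕ) : ℤ) d :=
      Nat.isCoprime_iff_coprime.2 (Nat.Coprime.pow_left _ ((Nat.Prime.coprime_iff_not_dvd hpp).2 hd))
    obtain ⟨s, t, hst⟩ := hcop
    -- Here `r = x / u` has denominator `p ^ j * d` with `p ∤ d`, and `p ^ (j + 1) • v = u`, so `d *
    -- x = r.num * p * v`. Multiplying the witness by `p` thus gives `(s * p ^ (j + 1) + t * d) * x
    -- = x`.
    refine ⟨(s * p ^ j) • x + (t * r.num) • v, ?_⟩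
    ext
    have h1 : ((p ^ j * d : ℕ) : ℚ) * x = r.num * u := by
      have h2 : (r.num : ℚ) = r * r.den := (Rat.mul_den_eq_num r).symm
      have h7 : r * u = x := div_mul_cancel₀ _ hu'
      rw [h2, ← hjd]
      linear_combination -(r.den : ℚ) * h7
    have h3 : (p : ℚ) ^ (j + 1) * v = u := by
      have := congrArg (Subtype.val) hv
      simpa using this
    have h4 : (s : ℚ) * p ^ (j + 1) + t * d = 1 := by exact_mod_cast hst
    push_cast at h1 ⊢
    simp only [nsmul_eq_mul, zsmul_eq_mul]
    push_cast
    have h5 : (p : ℚ) ^ j ≠ 0 := pow_ne_zero _ hp0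
    have h6 : (d : ℚ) * x = r.num * (p * v) := by
      apply mul_left_cancel₀ h5
      rw [← mul_assoc, h1, ← h3]; ring
    calc (p : ℚ) * (s * p ^ j * x + t * r.num * v)
        = s * p ^ (j + 1) * x + t * (r.num * (p * v)) := by ring
      _ = (s * p ^ (j + 1) + t * d) * x := by rw [← h6]; ring
      _ = x := by rw [h4, one_mul]

/-- Both properties hold in `G` and pass along isomorphisms, and together they determine the group.
The Scott sentence and the index set computation both start here. -/
theorem nonempty_equiv_iff (hu : u ≠ 0) (hfin : primesFin u = ∅) (hinf : primesInf u = X)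
    (M : Type) [groupLang.Structure M] :
    Nonempty (FirstOrder.Language.Equiv groupLang M G) ↔ IsRankOneDivisible X M ∧ HasBase X M := by
  have h0 : 0 ∉ X := fun h => by
    rw [← hinf] at h
    exact Nat.not_prime_zero h.1
  constructor
  · rintro ⟨e⟩
    exact ⟨(isRankOneDivisible_of_primes hu hinf).of_equiv e, (hasBase_of_primes hu hfin hinf).of_equiv e⟩
  · rintro ⟨h1, h2⟩
    exact h1.nonempty_equiv h2 (isRankOneDivisible_of_primes hu hinf)
      (hasBase_of_primes hu hfin hinf) h0

end Rational

open FirstOrder FirstOrder.Language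

/-! ### Terms and their codes -/

section Terms
variable {α : Type}

/-- The identity, as a term. -/
def tOne : groupLang.Term α := Term.func (GroupFunc.one : groupLang.Functions 0) ![]
/-- The inverse of a term. -/
def tInv (t : groupLang.Term α) : groupLang.Term α :=
  Term.func (GroupFunc.inv : groupLang.Functions 1) ![t]
/-- The product of two terms. -/
def tMul (s t : groupLang.Term α) : groupLang.Term α :=
  Term.func (GroupFunc.mul : groupLang.Functions 2) ![s, t]
/-- Powers of a term. -/
def tPow : ℕ → groupLang.Term α → groupLang.Term α
  | 0, _ => tOne
  | k + 1, t => tMul (tPow k t) t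

/-- The code of the product of two terms. -/
def cMul (a b : ℕ) : ℕ := 4 * Nat.pair a b + 3
/-- The code of the inverse of a term. -/
def cInv (a : ℕ) : ℕ := 4 * a + 2
/-- The code of a power of a term. -/
def cPow : ℕ → ℕ → ℕ
  | 0, _ => 1
  | k + 1, a => cMul (cPow k a) a

@[simp] theorem termCode_var (v : α → ℕ) (a : α) : termCode v (.var a) = 4 * v a := rfl
@[simp] theorem termCode_tOne (v : α → ℕ) : termCode v tOne = 1 := rfl
@[simp] theorem termCode_tInv (v : α → ℕ) (t : groupLang.Term α) :
    termCode v (tInv t) = cInv (termCode v t) := rfl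
@[simp] theorem termCode_tMul (v : α → ℕ) (s t : groupLang.Term α) :
    termCode v (tMul s t) = cMul (termCode v s) (termCode v t) := rfl
@[simp] theorem termCode_tPow (v : α → ℕ) (k : ℕ) (t : groupLang.Term α) :
    termCode v (tPow k t) = cPow k (termCode v t) := by
  induction k with
  | zero => rfl
  | succ k ih => rw [tPow, termCode_tMul, ih, cPow]

variable {M : Type} [groupLang.Structure M]

@[simp] theorem realize_tOne (v : α → M) : (tOne : groupLang.Term α).realize v = gOne :=
  funMap_one _
@[simp] theorem realize_tInv (v : α → M) (t : groupLang.Term α) :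
    (tInv t).realize v = gInv (t.realize v) := funMap_inv _
@[simp] theorem realize_tMul (v : α → M) (s t : groupLang.Term α) :
    (tMul s t).realize v = gMul (s.realize v) (t.realize v) := funMap_mul _
@[simp] theorem realize_tPow (v : α → M) (k : ℕ) (t : groupLang.Term α) :
    (tPow k t).realize v = gPow k (t.realize v) := by
  induction k with
  | zero => exact realize_tOne v
  | succ k ih => rw [tPow, realize_tMul, ih, gPow]

/-- Induction on terms in the language of groups. -/
theorem term_induction {p : groupLang.Term α → Prop} (var : ∀ a, p (.var a)) (one : p tOne)
    (inv : ∀ t, p t → p (tInv t)) (mul : ∀ s t, p s → p t → p (tMul s t)) (t) : p t := by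
  induction t with
  | var a => exact var a
  | @func l f ts ih =>
    change GroupFunc l at f
    cases f
    · have : ts = ![] := Subsingleton.elim _ _
      rw [this]; exact one
    · have : ts = ![ts 0] := by ext i; fin_cases i; rfl
      rw [this]; exact inv _ (ih 0)
    · have : ts = ![ts 0, ts 1] := by ext i; fin_cases i <;> rfl
      rw [this]; exact mul _ _ (ih 0) (ih 1)

theorem term_cases (t : groupLang.Term α) : (∃ a, t = .var a) ∨ t = tOne ∨ (∃ s, t = tInv s) ∨
    ∃ r s, t = tMul r s := by
  induction t using term_induction with
  | var a => exact Or.inl ⟨a, rfl⟩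
  | one => exact Or.inr (Or.inl rfl)
  | inv t _ => exact Or.inr (Or.inr (Or.inl ⟨t, rfl⟩))
  | mul s t _ _ => exact Or.inr (Or.inr (Or.inr ⟨s, t, rfl⟩))

/-- The residue of a code modulo 4 reveals the outermost symbol. -/
theorem termCode_injective {v : α → ℕ} (hv : Function.Injective v) :
    Function.Injective (termCode v) := by
  intro s
  induction s using term_induction with
  | var a =>
    intro t h
    obtain ⟨b, rfl⟩ | rfl | ⟨b, rfl⟩ | ⟨b, c, rfl⟩ := term_cases t <;>
      simp [cInv, cMul] at h <;> first | omega | skip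
    rw [hv h]
  | one =>
    intro t h
    obtain ⟨b, rfl⟩ | rfl | ⟨b, rfl⟩ | ⟨b, c, rfl⟩ := term_cases t <;>
      simp [cInv, cMul] at h <;> first | omega | rfl
  | inv a ih =>
    intro t h
    obtain ⟨b, rfl⟩ | rfl | ⟨b, rfl⟩ | ⟨b, c, rfl⟩ := term_cases t <;>
      simp [cInv, cMul] at h <;> first | omega | skip
    rw [ih h]
  | mul a b iha ihb =>
    intro t h
    obtain ⟨b, rfl⟩ | rfl | ⟨b, rfl⟩ | ⟨b, c, rfl⟩ := term_cases t <;>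
      simp [cInv, cMul] at h <;> first | omega | skip
    rw [iha h.1, ihb h.2]

theorem QFFormula.code_injective {k : ℕ} : Function.Injective (QFFormula.code (k := k)) := by
  have ht := termCode_injective (v := (Fin.val : Fin k → ℕ)) Fin.val_injective
  intro θ
  induction θ with
  | eq s t | ne s t =>
    intro η h
    cases η <;> simp only [QFFormula.code] at h <;> first | omega | skip
    rename_i s' t'
    have h' : Nat.pair (termCode Fin.val s) (termCode Fin.val t) =
      Nat.pair (termCode Fin.val s') (termCode Fin.val t') := by omega
    obtain ⟨h1, h2⟩ := Nat.pair_eq_pair.1 h'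
    rw [ht h1, ht h2]
  | and s t ihs iht | or s t ihs iht =>
    intro η h
    cases η <;> simp only [QFFormula.code] at h <;> first | omega | skip
    rename_i s' t'
    have h' : Nat.pair s.code t.code = Nat.pair s'.code t'.code := by omega
    obtain ⟨h1, h2⟩ := Nat.pair_eq_pair.1 h'
    rw [ihs h1, iht h2]

section Computability
variable {β : Type*} [Primcodable β] {f g : β → ℕ}

@[fun_prop] theorem computable_cMul (hf : Computable f) (hg : Computable g) :
    Computable fun b => cMul (f b) (g b) := by
  unfold cMul; fun_prop

@[fun_prop] theorem computable_cInv (hf : Computable f) : Computable fun b => cInv (f b) := by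
  unfold cInv; fun_prop

@[fun_prop] theorem computable_cPow (hf : Computable f) (hg : Computable g) :
    Computable fun b => cPow (f b) (g b) := by
  refine (Computable.nat_rec (h := fun b x => cMul x.2 (g b)) hf (Computable.const 1)
    (show Computable fun x : β × (ℕ × ℕ) => cMul x.2.2 (g x.1) by fun_prop)).of_eq fun b => ?_
  induction f b with
  | zero => rfl
  | succ k ih => simp only [ih, cPow]

end Computability

end Terms

/-! ### Indices of c.e. sets -/

/-- This is s-m-n through `Code.curry`. Injectivity of the index function matters later: different
inner formulas must not share an index. -/
theorem exists_ceSet_eq_of_rePred {Q : ℕ × ℕ → Prop} (hQ : REPred Q) :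
    ∃ f : ℕ → ℕ, Computable f ∧ Function.Injective f ∧ ∀ c, ceSet (f c) = {n | Q (c, n)} := by
  have h : REPred fun z : ℕ => Q z.unpair := hQ.comp Computable.unpair
  have h' : Nat.Partrec fun z : ℕ => (Part.assert (Q z.unpair) fun _ => Part.some 0 : Part ℕ) :=
    Partrec.nat_iff.1 ((Partrec.map h (Computable.const 0).to₂).of_eq fun z => by
      ext; simp [Part.mem_map_iff, eq_comm])
  obtain ⟨c, hc⟩ := Nat.Partrec.Code.exists_code.1 h'
  refine ⟨fun n => Encodable.encode (Nat.Partrec.Code.curry c n), ?_, ?_, fun n => ?_⟩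
  · exact Computable.encode.comp (Nat.Partrec.Code.primrec₂_curry.to_comp.comp
      (Computable.const c) Computable.id)
  · exact fun a b hab => (Nat.Partrec.Code.curry_inj (Encodable.encode_injective hab)).2
  · ext m
    simp [ceSet, partialComp, Nat.Partrec.Code.eval_curry, hc, Part.assert]

theorem exists_ceSet_eq {S : Set ℕ} (hS : REPred fun n => n ∈ S) : ∃ e, ceSet e = S := by
  obtain ⟨f, -, -, h⟩ := exists_ceSet_eq_of_rePred
    (Q := fun x => x.2 ∈ S) (hS.comp Computable.snd)
  exact ⟨f 0, h 0⟩

/-! ### Building infinitary formulas with given indices -/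

section Formulas
variable {W : ℕ → Set ℕ} {k n e : ℕ} {C : Set ℕ} {m j : ℕ} {i : ℕ → ℕ}
  {T : ℕ → ∀ (N : Type) [groupLang.Structure N], (Fin k → N) → Prop}

/-- A conjunct is known only through its index, so the parameter chosen for an element of `W e` may
differ from the one that produced it. The hypothesis `hinj` makes such a difference harmless. -/
theorem exists_conj (hW : W e = {z | ∃ c ∈ C, z = Nat.pair m (Nat.pair j (i c))}) (hj : j < n + 1)
    (hψ : ∀ c ∈ C, ∃ ψ : InfFormula (k + m), HasIndex W .sigma j (i c) ψ ∧
      ∀ (N : Type) [groupLang.Structure N] (v : Fin k → N),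
        (∀ w, ψ.Realize (Fin.append v w)) ↔ T c N v)
    (hinj : ∀ c ∈ C, ∀ c' ∈ C, i c = i c' →
      ∀ (N : Type) [groupLang.Structure N] (v : Fin k → N), T c N v → T c' N v) :
    ∃ φ : InfFormula k, HasIndex W .pi (n + 1) e φ ∧
      ∀ (N : Type) [groupLang.Structure N] (v : Fin k → N), φ.Realize v ↔ ∀ c ∈ C, T c N v := by
  have key : ∀ z : W e, ∃ c ∈ C, z.1 = Nat.pair m (Nat.pair j (i c)) ∧
      z.1.unpair.2.unpair.1 < n + 1 ∧ ∃ ψ : InfFormula (k + z.1.unpair.1),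
      HasIndex W .sigma z.1.unpair.2.unpair.1 z.1.unpair.2.unpair.2 ψ ∧
      ∀ (N : Type) [groupLang.Structure N] (v : Fin k → N),
        (∀ w, ψ.Realize (Fin.append v w)) ↔ T c N v := by
    intro z
    have hz : z.1 ∈ {z | ∃ c ∈ C, z = Nat.pair m (Nat.pair j (i c))} := hW ▸ z.2
    obtain ⟨c, hc, hz⟩ := hz
    refine ⟨c, hc, hz, ?_⟩
    have h1 : z.1.unpair.1 = m := by rw [hz]; simp
    have h2 : z.1.unpair.2.unpair.1 = j := by rw [hz]; simp
    have h3 : z.1.unpair.2.unpair.2 = i c := by rw [hz]; simp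
    rw [h1, h2, h3]
    exact ⟨hj, hψ c hc⟩
  choose c hc hz hlt ψ hψ hr using key
  refine ⟨_, HasIndex.conj n e ψ hlt hψ, fun N _ v => ?_⟩
  rw [InfFormula.Realize]
  simp only [hr]
  constructor
  · intro H c' hc'
    have hmem : Nat.pair m (Nat.pair j (i c')) ∈ W e := by rw [hW]; exact ⟨c', hc', rfl⟩
    refine hinj _ (hc ⟨_, hmem⟩) _ hc' ?_ N v (H ⟨_, hmem⟩)
    have := hz ⟨_, hmem⟩
    simp only [Nat.pair_eq_pair] at this
    exact this.2.2.symm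
  · exact fun H z => H _ (hc z)

theorem exists_disj (hW : W e = {z | ∃ c ∈ C, z = Nat.pair m (Nat.pair j (i c))}) (hj : j < n + 1)
    (hψ : ∀ c ∈ C, ∃ ψ : InfFormula (k + m), HasIndex W .pi j (i c) ψ ∧
      ∀ (N : Type) [groupLang.Structure N] (v : Fin k → N),
        (∃ w, ψ.Realize (Fin.append v w)) ↔ T c N v)
    (hinj : ∀ c ∈ C, ∀ c' ∈ C, i c = i c' →
      ∀ (N : Type) [groupLang.Structure N] (v : Fin k → N), T c N v → T c' N v) :
    ∃ φ : InfFormula k, HasIndex W .sigma (n + 1) e φ ∧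
      ∀ (N : Type) [groupLang.Structure N] (v : Fin k → N), φ.Realize v ↔ ∃ c ∈ C, T c N v := by
  have key : ∀ z : W e, ∃ c ∈ C, z.1 = Nat.pair m (Nat.pair j (i c)) ∧
      z.1.unpair.2.unpair.1 < n + 1 ∧ ∃ ψ : InfFormula (k + z.1.unpair.1),
      HasIndex W .pi z.1.unpair.2.unpair.1 z.1.unpair.2.unpair.2 ψ ∧
      ∀ (N : Type) [groupLang.Structure N] (v : Fin k → N),
        (∃ w, ψ.Realize (Fin.append v w)) ↔ T c N v := by
    intro z
    have hz : z.1 ∈ {z | ∃ c ∈ C, z = Nat.pair m (Nat.pair j (i c))} := hW ▸ z.2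
    obtain ⟨c, hc, hz⟩ := hz
    refine ⟨c, hc, hz, ?_⟩
    have h1 : z.1.unpair.1 = m := by rw [hz]; simp
    have h2 : z.1.unpair.2.unpair.1 = j := by rw [hz]; simp
    have h3 : z.1.unpair.2.unpair.2 = i c := by rw [hz]; simp
    rw [h1, h2, h3]
    exact ⟨hj, hψ c hc⟩
  choose c hc hz hlt ψ hψ hr using key
  refine ⟨_, HasIndex.disj n e ψ hlt hψ, fun N _ v => ?_⟩
  rw [InfFormula.Realize]
  simp only [hr]
  constructor
  · exact fun ⟨z, H⟩ => ⟨_, hc z, H⟩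
  · rintro ⟨c', hc', H⟩
    have hmem : Nat.pair m (Nat.pair j (i c')) ∈ W e := by rw [hW]; exact ⟨c', hc', rfl⟩
    refine ⟨⟨_, hmem⟩, hinj _ hc' _ (hc ⟨_, hmem⟩) ?_ N v H⟩
    have := hz ⟨_, hmem⟩
    simp only [Nat.pair_eq_pair] at this
    exact this.2.2

theorem exists_conj_qf {θ : ℕ → QFFormula (k + m)}
    (hW : W e = {z | ∃ c ∈ C, z = Nat.pair m (Nat.pair 0 (θ c).code)}) :
    ∃ φ : InfFormula k, HasIndex W .pi (n + 1) e φ ∧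
      ∀ (N : Type) [groupLang.Structure N] (v : Fin k → N),
        φ.Realize v ↔ ∀ c ∈ C, ∀ w : Fin m → N, (θ c).Realize (Fin.append v w) :=
  exists_conj (T := fun c N _ v => ∀ w : Fin m → N, (θ c).Realize (Fin.append v w)) hW (by omega)
    (fun c _ => ⟨_, HasIndex.qf _ (θ c), fun _ _ _ => Iff.rfl⟩)
    (fun c _ c' _ h N _ v => by rw [QFFormula.code_injective h]; exact id)

theorem exists_disj_qf {θ : ℕ → QFFormula (k + m)}
    (hW : W e = {z | ∃ c ∈ C, z = Nat.pair m (Nat.pair 0 (θ c).code)}) :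
    ∃ φ : InfFormula k, HasIndex W .sigma (n + 1) e φ ∧
      ∀ (N : Type) [groupLang.Structure N] (v : Fin k → N),
        φ.Realize v ↔ ∃ c ∈ C, ∃ w : Fin m → N, (θ c).Realize (Fin.append v w) :=
  exists_disj (T := fun c N _ v => ∃ w : Fin m → N, (θ c).Realize (Fin.append v w)) hW (by omega)
    (fun c _ => ⟨_, HasIndex.qf _ (θ c), fun _ _ _ => Iff.rfl⟩)
    (fun c _ c' _ h N _ v => by rw [QFFormula.code_injective h]; exact id)

end Formulas

/-! ### The Scott sentence -/

theorem computablePred_prime : ComputablePred Nat.Prime := by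
  have h : PrimrecRel fun m p : ℕ => ¬ p % m = 0 ∨ m = 1 :=
    PrimrecPred.or (PrimrecPred.not (Primrec.eq.comp
      (Primrec.nat_mod.comp Primrec.snd Primrec.fst) (Primrec.const 0)))
      (Primrec.eq.comp Primrec.fst (Primrec.const 1))
  have h2 : PrimrecPred fun p : ℕ => 2 ≤ p ∧ ∀ m < p, ¬ p % m = 0 ∨ m = 1 :=
    PrimrecPred.and (Primrec.nat_le.comp (Primrec.const 2) Primrec.id)
      (h.forall_lt.comp Primrec.id Primrec.id)
  refine h2.computablePred.of_eq fun p => ?_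
  rw [Nat.prime_def_lt]
  simp only [Nat.dvd_iff_mod_eq_zero, imp_iff_not_or]

/-- The quantifier-free parts of the axioms for torsion-free abelian groups of rank at most one with
all elements divisible by given numbers. -/
def axiomMatrix (c d : ℕ) : QFFormula 4 :=
  match c.unpair.1 with
  | 0 => .and (.eq (tMul (tMul (.var 0) (.var 1)) (.var 2)) (tMul (.var 0) (tMul (.var 1) (.var 2))))
      (.and (.eq (tMul (.var 0) (.var 1)) (tMul (.var 1) (.var 0)))
        (.and (.eq (tMul tOne (.var 0)) (.var 0)) (.eq (tMul (tInv (.var 0)) (.var 0)) tOne)))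
  | 1 => .or (.eq (.var 1) tOne) (.or (.eq (tPow (d.unpair.1 + 1) (.var 0)) (tPow d.unpair.2 (.var 1)))
      (.eq (tMul (tPow (d.unpair.1 + 1) (.var 0)) (tPow d.unpair.2 (.var 1))) tOne))
  | 2 => .or (.ne (tPow (c.unpair.2 + 1) (.var 0)) tOne) (.eq (.var 0) tOne)
  | _ => .eq (tPow c.unpair.2 (.var 3)) (.var 0)

/-- Variables `0`, `1` and `3` have codes `0`, `4` and `12`, the identity has code `1`, and the
block of group laws has a constant code. -/
theorem computable_code_axiomMatrix :
    Computable fun x : ℕ × ℕ => (axiomMatrix x.1 x.2).code := by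
  have h : Computable fun x : ℕ × ℕ =>
      bif decide (x.1.unpair.1 = 0) then (axiomMatrix 0 0).code
      else bif decide (x.1.unpair.1 = 1) then
        4 * Nat.pair (4 * Nat.pair 4 1) (4 * Nat.pair
          (4 * Nat.pair (cPow (x.2.unpair.1 + 1) 0) (cPow x.2.unpair.2 4))
          (4 * Nat.pair (cMul (cPow (x.2.unpair.1 + 1) 0) (cPow x.2.unpair.2 4)) 1) + 3) + 3
      else bif decide (x.1.unpair.1 = 2) then
        4 * Nat.pair (4 * Nat.pair (cPow (x.1.unpair.2 + 1) 0) 1 + 1) (4 * Nat.pair 0 1) + 3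
      else 4 * Nat.pair (cPow x.1.unpair.2 12) 0 := by fun_prop
  refine h.of_eq fun x => ?_
  unfold axiomMatrix
  rcases x.1.unpair.1 with _ | _ | _ | k <;> simp [QFFormula.code]

/-- The axioms used: all but the divisibility by numbers outside `X`. -/
def axiomSet (X : Set ℕ) : Set ℕ := {c | c.unpair.1 ≤ 2 ∨ c.unpair.2 ∈ X}

section
variable {N : Type} [groupLang.Structure N]

/-- The parameter `c` is a pair of an axiom type and a number, and `d` selects a disjunct, used only
by the rank axiom. Variables `0`, `1`, `2` are universal; variable `3` is existential and occurs
only in divisibility axioms. -/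
theorem forall_axiomSet_iff (X : Set ℕ) :
    (∀ c ∈ axiomSet X, ∀ w : Fin 3 → N, ∃ d, ∃ t : Fin 1 → N,
      (axiomMatrix c d).Realize (Fin.append (Fin.append (Fin.elim0 : Fin 0 → N) w) t)) ↔
      IsRankOneDivisible X N := by
  have h0 : ∀ (w : Fin 3 → N) (t : Fin 1 → N), (Fin.append (Fin.append (Fin.elim0 : Fin 0 → N) w) t :
      Fin 4 → N) = ![w 0, w 1, w 2, t 0] := fun w t => by
    funext i; fin_cases i <;> rfl
  constructor
  · intro H
    have hax := fun x y z : N => H (Nat.pair 0 0) (Or.inl (by simp)) ![x, y, z]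
    simp only [h0, axiomMatrix, QFFormula.Realize, Nat.unpair_pair] at hax
    simp at hax
    refine ⟨fun x y z => ?_, fun x y => ?_, fun x => ?_, fun x => ?_, fun k x hx => ?_,
      fun x y => ?_, fun p hp x => ?_⟩
    · exact (hax x y z).1
    · exact (hax x y y).2.1
    · exact (hax x x x).2.2.1
    · exact (hax x x x).2.2.2.2
    · obtain ⟨d, t, h⟩ := H (Nat.pair 2 k) (Or.inl (by simp)) ![x, x, x]
      simp [axiomMatrix, QFFormula.Realize] at h
      exact h.resolve_left (not_not.2 hx)
    · obtain ⟨d, t, h⟩ := H (Nat.pair 1 0) (Or.inl (by simp)) ![x, y, y]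
      simp [axiomMatrix, QFFormula.Realize] at h
      exact h.imp_right fun h => ⟨_, _, h⟩
    · obtain ⟨d, t, h⟩ := H (Nat.pair 3 p) (Or.inr (by simpa using hp)) ![x, x, x]
      simp [axiomMatrix, QFFormula.Realize] at h
      exact ⟨_, h⟩
  · intro H c hc w
    obtain ⟨⟨a, k⟩, rfl⟩ : ∃ x : ℕ × ℕ, c = Nat.pair x.1 x.2 := ⟨c.unpair, by simp⟩
    simp only [h0]
    rcases a with _ | _ | _ | a
    · refine ⟨0, fun _ => w 0, ?_⟩
      simp [axiomMatrix, QFFormula.Realize, H.assoc, H.comm (w 0), H.one_mul, H.inv_mul]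
    · rcases H.rank (w 0) (w 1) with h | ⟨m, n, h⟩
      · exact ⟨0, fun _ => w 0, by simp [axiomMatrix, QFFormula.Realize, h]⟩
      · exact ⟨Nat.pair m n, fun _ => w 0, by simp [axiomMatrix, QFFormula.Realize, h]⟩
    · refine ⟨0, fun _ => w 0, ?_⟩
      simp [axiomMatrix, QFFormula.Realize]
      exact (em (gPow (k + 1) (w 0) = gOne)).elim (fun h => Or.inr (H.torsionFree k _ h)) Or.inl
    · have hk : k ∈ X := by
        rcases hc with h | h
        · simp at h
        · simpa using h
      obtain ⟨y, hy⟩ := H.div k hk (w 0)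
      exact ⟨0, fun _ => y, by simp [axiomMatrix, QFFormula.Realize, hy]⟩

end

/-- Every axiom has the shape `∀ x₀ x₁ x₂, ⋁ d, ∃ x₃` before a quantifier-free matrix, and the set
of axioms is c.e. because `X` is. -/
theorem exists_computablePi {X : Set ℕ} (hX : REPred fun p => p ∈ X) :
    ∃ φ : InfSentence, IsComputablePi 2 φ ∧
      ∀ (N : Type) [groupLang.Structure N], φ.Holds N ↔ IsRankOneDivisible X N := by
  have hcode : REPred fun x : ((ℕ × ℕ) × ℕ) =>
      x.1.2 = Nat.pair 1 (Nat.pair 0 (axiomMatrix x.1.1 x.2).code) := by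
    have h := computable_code_axiomMatrix.comp (g := fun x : (ℕ × ℕ) × ℕ => (x.1.1, x.2))
      (by fun_prop)
    exact (ComputablePred.natEq (by fun_prop) (by fun_prop)).to_re
  obtain ⟨g, hg, hginj, hgs⟩ := exists_ceSet_eq_of_rePred hcode.exists_nat
  -- The index `⟨3, ⟨1, g c⟩⟩` stands for three universal variables before the `Σ₁` formula with
  -- index `g c`.
  have hC : REPred fun x : ℕ × ℕ => x.2 ∈ axiomSet X ∧ x.1 = Nat.pair 3 (Nat.pair 1 (g x.2)) := by
    refine REPred.and (REPred.or ?_ ?_) (ComputablePred.natEq (by fun_prop) (by fun_prop)).to_re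
    · exact (Primrec.nat_le.comp (Primrec.fst.comp (Primrec.unpair.comp Primrec.snd))
        (Primrec.const 2)).computablePred.to_re
    · exact hX.comp (f := fun x : ℕ × ℕ => x.2.unpair.2) (by fun_prop)
  obtain ⟨e, he⟩ := exists_ceSet_eq (S := {z | ∃ c ∈ axiomSet X, z = Nat.pair 3 (Nat.pair 1 (g c))})
    hC.exists_nat
  have hinner : ∀ c, ∃ ψ : InfFormula (0 + 3), HasIndex ceSet .sigma 1 (g c) ψ ∧
      ∀ (N : Type) [groupLang.Structure N] (v : Fin (0 + 3) → N),
        ψ.Realize v ↔ ∃ d ∈ Set.univ, ∃ w : Fin 1 → N,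
          QFFormula.Realize (k := 0 + 3 + 1) (Fin.append v w) (axiomMatrix c d) := fun c =>
    exists_disj_qf (W := ceSet) (e := g c) (m := 1) (n := 0) (C := Set.univ) (θ := fun d => (axiomMatrix c d : QFFormula (0 + 3 + 1)))
      (by rw [hgs]; simp)
  obtain ⟨φ, hφ, hr⟩ := exists_conj (k := 0) (n := 1) (T := fun c N _ v => ∀ w : Fin 3 → N,
    ∃ d ∈ Set.univ, ∃ t : Fin 1 → N, QFFormula.Realize (k := 0 + 3 + 1)
      (Fin.append (Fin.append v w) t) (axiomMatrix c d)) he (by omega)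
    (fun c _ => (hinner c).imp fun ψ h => ⟨h.1, fun N _ v => forall_congr' fun w => h.2 N _⟩)
    (fun c _ c' _ h N _ v => by rw [hginj h]; exact id)
  refine ⟨φ, ⟨e, hφ⟩, fun N _ => ?_⟩
  rw [InfSentence.Holds, hr, ← forall_axiomSet_iff]
  simp only [Set.mem_univ, true_and]

/-- The sentence is `∃ u, ⋀ p, ∀ y, p y ≠ u`, with `p` ranging over zero and the primes outside `X`,
an index set c.e. in `X`. -/
theorem exists_relComputableSigma (X : Set ℕ) :
    ∃ ψ : InfSentence, IsRelComputableSigma X 2 ψ ∧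
      ∀ (N : Type) [groupLang.Structure N], ψ.Holds N ↔ HasBase X N := by
  let θ : ℕ → QFFormula (0 + 1 + 1) := fun p =>
    (.ne (tPow p (.var 1)) (.var 0) : QFFormula 2)
  have hθ : Computable fun p => (θ p).code := by
    have : Computable fun p => 4 * Nat.pair (cPow p 4) 0 + 1 := by fun_prop
    refine this.of_eq fun p => ?_
    simp [θ, QFFormula.code]
  let C : Set ℕ := {p | p ∉ X ∧ (p = 0 ∨ p.Prime)}
  have h1 : CEIn X {z | ∃ c ∈ C, z = Nat.pair 1 (Nat.pair 0 (θ c).code)} := by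
    have hpr : ComputablePred fun x : ℕ × ℕ => x.2 = 0 ∨ x.2.Prime :=
      (ComputablePred.natEq (by fun_prop) (by fun_prop)).or
        (computablePred_prime.comp (f := fun x : ℕ × ℕ => x.2) (by fun_prop))
    have := CEIn.exists_notMem (Y := X) (hpr.and (ComputablePred.natEq
      (f := fun x : ℕ × ℕ => x.1) (g := fun x => Nat.pair 1 (Nat.pair 0 (θ x.2).code))
      (by fun_prop) (Computable.natPair (Computable.const 1) (Computable.natPair
        (Computable.const 0) (hθ.comp Computable.snd))))).to_re
    convert this using 1
    ext z
    simp [C, and_assoc]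
  obtain ⟨i, hi⟩ := h1.exists_relCE
  obtain ⟨ψ, hψ, hψr⟩ := exists_conj_qf (k := 0 + 1) (m := 1) (n := 0) hi
  -- The outer disjunction has one disjunct: a single existential variable before the `Π₁` formula
  -- with index `i`.
  obtain ⟨e, he⟩ := (CEIn.of_rePred (Y := X) (S := {z | ∃ c ∈ ({i} : Set ℕ),
    z = Nat.pair 1 (Nat.pair 1 c)}) (by
      simpa using (ComputablePred.natEq Computable.id (Computable.const _)).to_re)).exists_relCE
  obtain ⟨φ, hφ, hr⟩ := exists_disj (k := 0) (n := 1) (i := id) (T := fun c N _ v =>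
    ∃ w : Fin 1 → N, ψ.Realize (Fin.append v w)) he (by omega)
    (fun c hc => ⟨ψ, by rw [Set.mem_singleton_iff.1 hc]; exact ⟨hψ, fun _ _ _ => Iff.rfl⟩⟩)
    (fun c _ c' _ h N _ v => id)
  refine ⟨φ, ⟨e, hφ⟩, fun N _ => ?_⟩
  rw [InfSentence.Holds, hr]
  simp only [hψr, Set.mem_singleton_iff, exists_eq_left]
  have h0 : ∀ w t : Fin 1 → N, (Fin.append (Fin.append (Fin.elim0 : Fin 0 → N) w) t :
      Fin 2 → N) = ![w 0, t 0] := fun w t => by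
    funext i; fin_cases i <;> rfl
  have hreal : ∀ (w t : Fin 1 → N) (c : ℕ), (θ c).Realize
      (Fin.append (Fin.append (Fin.elim0 : Fin 0 → N) w) t) ↔ gPow c (t 0) ≠ w 0 := by
    intro w t c
    simp only [θ]
    change (QFFormula.ne (k := 2) _ _).Realize _ ↔ _
    rw [h0]
    simp [QFFormula.Realize]
  simp only [hreal]
  constructor
  · rintro ⟨w, h⟩
    exact ⟨w 0, fun p hp hpp y => h p ⟨hp, hpp⟩ fun _ => y⟩
  · rintro ⟨u, h⟩
    exact ⟨fun _ => u, fun p hp t => h p hp.1 hp.2 (t 0)⟩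

/-! ### Atomic diagrams -/

theorem termCode_val_injective {U : Set ℕ} :
    Function.Injective (termCode (Subtype.val : U → ℕ)) :=
  termCode_injective Subtype.val_injective

section Diagram
variable {U : Set ℕ} [groupLang.Structure U]

/-- `c` is the code of a term over `U` with value `x`. -/
def CodeVal (U : Set ℕ) [groupLang.Structure U] (c : ℕ) (x : U) : Prop :=
  ∃ t : groupLang.Term U, termCode Subtype.val t = c ∧ t.realize id = x

theorem CodeVal.unique {c : ℕ} {x y : U} (hx : CodeVal U c x) (hy : CodeVal U c y) : x = y := by
  obtain ⟨s, rfl, rfl⟩ := hx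
  obtain ⟨t, h, rfl⟩ := hy
  rw [termCode_val_injective h]

theorem codeVal_var {a : ℕ} {x : U} : CodeVal U (4 * a) x ↔ a = x := by
  constructor
  · rintro ⟨t, h, rfl⟩
    obtain ⟨b, rfl⟩ | rfl | ⟨b, rfl⟩ | ⟨b, c, rfl⟩ := term_cases t <;>
      simp [cInv, cMul] at h <;> first | omega | skip
    simp [h]
  · rintro rfl
    exact ⟨.var x, rfl, rfl⟩

theorem codeVal_one {x : U} : CodeVal U 1 x ↔ x = gOne := by
  have h1 : CodeVal U 1 gOne := ⟨tOne, rfl, realize_tOne _⟩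
  exact ⟨fun h => h.unique h1, fun h => h ▸ h1⟩

theorem codeVal_inv {c : ℕ} {x : U} : CodeVal U (cInv c) x ↔ ∃ y, CodeVal U c y ∧ x = gInv y := by
  constructor
  · rintro ⟨t, h, rfl⟩
    obtain ⟨b, rfl⟩ | rfl | ⟨b, rfl⟩ | ⟨b, c, rfl⟩ := term_cases t <;>
      simp [cInv, cMul] at h <;> first | omega | skip
    exact ⟨_, ⟨b, h, rfl⟩, realize_tInv _ _⟩
  · rintro ⟨y, ⟨t, rfl, rfl⟩, rfl⟩
    exact ⟨tInv t, rfl, realize_tInv _ _⟩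

theorem codeVal_mul {c d : ℕ} {x : U} :
    CodeVal U (cMul c d) x ↔ ∃ y z, CodeVal U c y ∧ CodeVal U d z ∧ x = gMul y z := by
  constructor
  · rintro ⟨t, h, rfl⟩
    obtain ⟨b, rfl⟩ | rfl | ⟨b, rfl⟩ | ⟨a, b, rfl⟩ := term_cases t <;>
      simp [cInv, cMul] at h <;> first | omega | skip
    exact ⟨_, _, ⟨a, h.1, rfl⟩, ⟨b, h.2, rfl⟩, realize_tMul _ _ _⟩
  · rintro ⟨y, z, ⟨s, rfl, rfl⟩, ⟨t, rfl, rfl⟩, rfl⟩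
    exact ⟨tMul s t, rfl, realize_tMul _ _ _⟩

/-- The only term code congruent to 1 modulo 4 is `1` itself. -/
theorem not_codeVal {k : ℕ} {x : U} : ¬ CodeVal U (4 * k + 5) x := by
  rintro ⟨t, h, rfl⟩
  obtain ⟨b, rfl⟩ | rfl | ⟨b, rfl⟩ | ⟨b, c, rfl⟩ := term_cases t <;>
    simp [cInv, cMul] at h <;> omega

theorem CodeVal.pow {c : ℕ} {x : U} (k : ℕ) (h : CodeVal U c x) :
    CodeVal U (cPow k c) (gPow k x) := by
  induction k with
  | zero => exact codeVal_one.2 rfl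
  | succ k ih => exact codeVal_mul.2 ⟨_, _, ih, h, rfl⟩

/-- The exponent must be nonzero: `cPow 0 c` is the code of the identity even when `c` codes no
term. -/
theorem codeVal_pow {c k : ℕ} {x : U} (hk : k ≠ 0) :
    CodeVal U (cPow k c) x ↔ ∃ y, CodeVal U c y ∧ x = gPow k y := by
  constructor
  · intro h
    obtain ⟨k, rfl⟩ := Nat.exists_eq_succ_of_ne_zero hk
    obtain ⟨_, z, -, hz, -⟩ := codeVal_mul.1 h
    exact ⟨z, hz, h.unique (hz.pow _)⟩
  · rintro ⟨y, hy, rfl⟩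
    exact hy.pow k

theorem mem_atomicDiagram_eq {a b : ℕ} :
    2 * Nat.pair a b ∈ atomicDiagram U ↔ ∃ x, CodeVal U a x ∧ CodeVal U b x := by
  constructor
  · rintro ⟨s, t, ⟨h, h'⟩ | ⟨h, -⟩⟩
    · obtain ⟨rfl, rfl⟩ := Nat.pair_eq_pair.1 
        (by omega : Nat.pair a b = Nat.pair (termCode Subtype.val s) (termCode Subtype.val t))
      exact ⟨_, ⟨s, rfl, rfl⟩, ⟨t, rfl, h'.symm⟩⟩
    · omega
  · rintro ⟨x, ⟨s, rfl, rfl⟩, ⟨t, rfl, h⟩⟩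
    exact ⟨s, t, Or.inl ⟨rfl, h.symm⟩⟩

theorem mem_atomicDiagram_ne {a b : ℕ} :
    2 * Nat.pair a b + 1 ∈ atomicDiagram U ↔ ∃ x y, CodeVal U a x ∧ CodeVal U b y ∧ x ≠ y := by
  constructor
  · rintro ⟨s, t, ⟨h, -⟩ | ⟨h, h'⟩⟩
    · omega
    · obtain ⟨rfl, rfl⟩ := Nat.pair_eq_pair.1 
        (by omega : Nat.pair a b = Nat.pair (termCode Subtype.val s) (termCode Subtype.val t))
      exact ⟨_, _, ⟨s, rfl, rfl⟩, ⟨t, rfl, rfl⟩, h'⟩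
  · rintro ⟨x, y, ⟨s, rfl, rfl⟩, ⟨t, rfl, rfl⟩, h⟩
    exact ⟨s, t, Or.inr ⟨rfl, h⟩⟩

end Diagram

/-! ### Atomic diagrams axiomatized by conditions on codes -/

/-- The partial function `φ` says that the equation between the terms coded by `s` and `t` holds. -/
def EqIn (φ : ℕ →. ℕ) (s t : ℕ) : Prop := 1 ∈ φ (2 * Nat.pair s t)

/-- `φ` is the characteristic function of an atomic diagram, as a list of conditions on codes. -/
structure IsDiagram (φ : ℕ →. ℕ) : Prop where
  total : ∀ n, 0 ∈ φ n ∨ 1 ∈ φ n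
  ne_iff : ∀ s t, EqIn φ s s ∧ EqIn φ t t →
    (EqIn φ s t ∧ 0 ∈ φ (2 * Nat.pair s t + 1)) ∨
      (0 ∈ φ (2 * Nat.pair s t) ∧ 1 ∈ φ (2 * Nat.pair s t + 1))
  ne_term : ∀ s t, 1 ∈ φ (2 * Nat.pair s t + 1) → EqIn φ s s ∧ EqIn φ t t
  symm : ∀ s t, EqIn φ s t → EqIn φ t s
  trans : ∀ s t r, EqIn φ s t ∧ EqIn φ t r → EqIn φ s r
  inv : ∀ s t, EqIn φ s t → EqIn φ (cInv s) (cInv t)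
  mul : ∀ s t s' t', EqIn φ s t ∧ EqIn φ s' t' → EqIn φ (cMul s s') (cMul t t')
  one : EqIn φ 1 1
  junk : ∀ k, EqIn φ (4 * k + 5) (4 * k + 5) → False
  inv_term : ∀ s, EqIn φ (cInv s) (cInv s) → EqIn φ s s
  mul_term : ∀ s t, EqIn φ (cMul s t) (cMul s t) → EqIn φ s s ∧ EqIn φ t t
  var : ∀ a b, EqIn φ (4 * a) (4 * b) → a = b
  value : ∀ s, EqIn φ s s → ∃ a, EqIn φ s (4 * a)

/-- The conditions on codes saying that a structure is a torsion-free abelian group of rank at most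
one all of whose elements are divisible by all elements of `X`. -/
structure IsRankOneDiagram (X : Set ℕ) (φ : ℕ →. ℕ) : Prop where
  laws : ∀ s t r, EqIn φ s s ∧ EqIn φ t t ∧ EqIn φ r r →
    EqIn φ (cMul (cMul s t) r) (cMul s (cMul t r)) ∧ EqIn φ (cMul s t) (cMul t s) ∧
      EqIn φ (cMul 1 s) s ∧ EqIn φ (cMul (cInv s) s) 1
  torsionFree : ∀ k s, EqIn φ (cPow (k + 1) s) 1 → EqIn φ s 1
  rank : ∀ s t, EqIn φ s s ∧ EqIn φ t t → EqIn φ t 1 ∨ ∃ n : ℕ,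
    EqIn φ (cPow (n.unpair.1 + 1) s) (cPow n.unpair.2 t) ∨
      EqIn φ (cMul (cPow (n.unpair.1 + 1) s) (cPow n.unpair.2 t)) 1
  div : ∀ p s, p ∈ X ∧ EqIn φ s s → ∃ t, EqIn φ (cPow p t) s

section
variable {U : Set ℕ} [groupLang.Structure U] {φ : ℕ →. ℕ}

theorem one_mem_charFn {S : Set ℕ} {n : ℕ} : 1 ∈ charFn S n ↔ n ∈ S := by
  rw [charFn_eq]; simp [eq_comm, chi_eq_one_iff]

theorem zero_mem_charFn {S : Set ℕ} {n : ℕ} : 0 ∈ charFn S n ↔ n ∉ S := by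
  rw [charFn_eq]; simp [eq_comm, chi_eq_zero_iff]

theorem eqIn_atomicDiagram {a b : ℕ} :
    EqIn (charFn (atomicDiagram U)) a b ↔ ∃ x, CodeVal U a x ∧ CodeVal U b x := by
  rw [EqIn, one_mem_charFn, mem_atomicDiagram_eq]

theorem eqIn_self_atomicDiagram {a : ℕ} :
    EqIn (charFn (atomicDiagram U)) a a ↔ ∃ x, CodeVal U a x := by
  simp [eqIn_atomicDiagram]

theorem isDiagram_atomicDiagram (U : Set ℕ) [groupLang.Structure U] :
    IsDiagram (charFn (atomicDiagram U)) where
  total n := by rw [one_mem_charFn, zero_mem_charFn]; tauto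
  ne_iff s t := by
    simp only [eqIn_self_atomicDiagram, eqIn_atomicDiagram, one_mem_charFn, zero_mem_charFn,
      mem_atomicDiagram_eq, mem_atomicDiagram_ne]
    rintro ⟨⟨x, hx⟩, ⟨y, hy⟩⟩
    by_cases h : x = y
    · subst h
      refine Or.inl ⟨⟨x, hx, hy⟩, ?_⟩
      rintro ⟨x', y', hx', hy', h⟩
      exact h ((hx'.unique hx).trans (hy.unique hy'))
    · refine Or.inr ⟨?_, x, y, hx, hy, h⟩
      rintro ⟨z, h1, h2⟩
      exact h ((hx.unique h1).trans (h2.unique hy))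
  ne_term s t := by
    simp only [eqIn_self_atomicDiagram, one_mem_charFn, mem_atomicDiagram_ne]
    rintro ⟨x, y, hx, hy, -⟩
    exact ⟨⟨x, hx⟩, y, hy⟩
  symm s t := by
    simp only [eqIn_atomicDiagram]
    exact fun ⟨x, h1, h2⟩ => ⟨x, h2, h1⟩
  trans s t r := by
    simp only [eqIn_atomicDiagram]
    rintro ⟨⟨x, h1, h2⟩, y, h3, h4⟩
    exact ⟨x, h1, h2.unique h3 ▸ h4⟩
  inv s t := by
    simp only [eqIn_atomicDiagram, codeVal_inv]
    rintro ⟨x, h1, h2⟩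
    exact ⟨_, ⟨x, h1, rfl⟩, x, h2, rfl⟩
  mul s t s' t' := by
    simp only [eqIn_atomicDiagram, codeVal_mul]
    rintro ⟨⟨x, h1, h2⟩, y, h3, h4⟩
    exact ⟨_, ⟨x, y, h1, h3, rfl⟩, x, y, h2, h4, rfl⟩
  one := eqIn_self_atomicDiagram.2 ⟨_, codeVal_one.2 rfl⟩
  junk k h := by
    obtain ⟨x, hx⟩ := eqIn_self_atomicDiagram.1 h
    exact not_codeVal hx
  inv_term s := by
    simp only [eqIn_self_atomicDiagram, codeVal_inv]
    rintro ⟨_, x, hx, -⟩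
    exact ⟨x, hx⟩
  mul_term s t := by
    simp only [eqIn_self_atomicDiagram, codeVal_mul]
    rintro ⟨_, x, y, hx, hy, -⟩
    exact ⟨⟨x, hx⟩, y, hy⟩
  var a b := by
    simp only [eqIn_atomicDiagram, codeVal_var]
    rintro ⟨x, rfl, rfl⟩; rfl
  value s := by
    simp only [eqIn_self_atomicDiagram, eqIn_atomicDiagram, codeVal_var]
    rintro ⟨x, hx⟩
    exact ⟨x, x, hx, rfl⟩

/-- The universe consists of the numbers `a` whose name satisfies its own self-equation, and `value`
supplies the operations. No quotient is needed, since `var` keeps distinct names apart. The clauses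
`junk`, `inv_term` and `mul_term` ensure that only genuine term codes satisfy self-equations. -/
theorem IsDiagram.exists_structure (h : IsDiagram φ) :
    ∃ (U : Set ℕ) (_ : groupLang.Structure U), φ = charFn (atomicDiagram U) := by
  have hl : ∀ {s t}, EqIn φ s t → EqIn φ s s := fun hst => h.trans _ _ _ ⟨hst, h.symm _ _ hst⟩
  have hr : ∀ {s t}, EqIn φ s t → EqIn φ t t := fun hst => hl (h.symm _ _ hst)
  let U : Set ℕ := {a | EqIn φ (4 * a) (4 * a)}
  have hU : ∀ s, EqIn φ s s → ∃ a : U, EqIn φ s (4 * a) := fun s hs => by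
    obtain ⟨a, ha⟩ := h.value s hs
    exact ⟨⟨a, hr ha⟩, ha⟩
  choose val hval using hU
  let struc : groupLang.Structure U :=
    { funMap := fun {n} f => match n, f with
        | _, GroupFunc.one => fun _ => val 1 h.one
        | _, GroupFunc.inv => fun x => val (cInv (4 * x 0)) (h.inv _ _ (x 0).2)
        | _, GroupFunc.mul => fun x => val (cMul (4 * x 0) (4 * x 1))
            (h.mul _ _ _ _ ⟨(x 0).2, (x 1).2⟩)
      RelMap := fun {_} r => Empty.elim r }
  refine ⟨U, struc, ?_⟩
  have hterm : ∀ t : groupLang.Term U,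
      EqIn φ (termCode Subtype.val t) (4 * (t.realize id : U)) := by
    intro t
    induction t using term_induction with
    | var a => exact a.2
    | one => exact hval 1 h.one
    | inv t ih =>
      rw [realize_tInv, termCode_tInv]
      exact h.trans _ _ _ ⟨h.inv _ _ ih, hval (cInv (4 * (t.realize id : U))) _⟩
    | mul s t ihs iht =>
      rw [realize_tMul, termCode_tMul]
      exact h.trans _ _ _ ⟨h.mul _ _ _ _ ⟨ihs, iht⟩,
        hval (cMul (4 * (s.realize id : U)) (4 * (t.realize id : U))) _⟩
  have hex : ∀ c, EqIn φ c c → ∃ t : groupLang.Term U, termCode Subtype.val t = c := by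
    intro c
    induction c using Nat.strong_induction_on with
    | _ c ih =>
      intro hc
      -- Every number is a possible variable code, the code of the identity, excluded by `junk`, or
      -- built from smaller codes.
      obtain ⟨k, hk⟩ : ∃ k, c = 4 * k ∨ c = 1 ∨ c = 4 * k + 5 ∨ c = cInv k ∨
          c = cMul k.unpair.1 k.unpair.2 := by
        simp only [cInv, cMul, Nat.pair_unpair]
        by_cases h5 : c % 4 = 1
        · exact ⟨(c - 5) / 4, by omega⟩
        · exact ⟨c / 4, by omega⟩
      rcases hk with rfl | rfl | rfl | rfl | rfl
      · exact ⟨.var ⟨k, hc⟩, rfl⟩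
      · exact ⟨tOne, rfl⟩
      · exact (h.junk k hc).elim
      · obtain ⟨t, ht⟩ := ih k (by unfold cInv; omega) (h.inv_term _ hc)
        exact ⟨tInv t, by rw [termCode_tInv, ht]⟩
      · have h1 := Nat.unpair_left_le k
        have h2 := Nat.unpair_right_le k
        obtain ⟨s, hs⟩ := ih k.unpair.1 (by simp only [cMul, Nat.pair_unpair]; omega)
          (h.mul_term _ _ hc).1
        obtain ⟨t, ht⟩ := ih k.unpair.2 (by simp only [cMul, Nat.pair_unpair]; omega)
          (h.mul_term _ _ hc).2
        exact ⟨tMul s t, by rw [termCode_tMul, hs, ht]⟩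
  have hcv : ∀ (c : ℕ) (x : U), CodeVal U c x ↔ EqIn φ c (4 * x) := by
    intro c x
    constructor
    · rintro ⟨t, rfl, rfl⟩
      exact hterm t
    · intro hc
      obtain ⟨t, rfl⟩ := hex c (hl hc)
      refine ⟨t, rfl, Subtype.ext (h.var _ _ ?_)⟩
      exact h.trans _ _ _ ⟨h.symm _ _ (hterm t), hc⟩
  have heq : ∀ s t, EqIn φ s t ↔ 2 * Nat.pair s t ∈ atomicDiagram U := by
    intro s t
    rw [mem_atomicDiagram_eq]
    simp only [hcv]
    constructor
    · intro hst
      exact ⟨val s (hl hst), hval _ _, h.trans _ _ _ ⟨h.symm _ _ hst, hval _ _⟩⟩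
    · rintro ⟨x, h1, h2⟩
      exact h.trans _ _ _ ⟨h1, h.symm _ _ h2⟩
  have hne : ∀ s t, 1 ∈ φ (2 * Nat.pair s t + 1) ↔ 2 * Nat.pair s t + 1 ∈ atomicDiagram U := by
    intro s t
    rw [mem_atomicDiagram_ne]
    constructor
    · intro hst
      obtain ⟨hs, ht⟩ := h.ne_term _ _ hst
      refine ⟨val s hs, val t ht, (hcv _ _).2 (hval _ _), (hcv _ _).2 (hval _ _), fun hc => ?_⟩
      rcases h.ne_iff s t ⟨hs, ht⟩ with ⟨-, h0⟩ | ⟨h0, -⟩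
      · exact absurd (Part.mem_unique h0 hst) (by simp)
      · have h1 : EqIn φ s t :=
          h.trans _ _ _ ⟨hval s hs, hc ▸ h.symm _ _ (hval t ht)⟩
        exact absurd (Part.mem_unique h0 h1) (by simp)
    · rintro ⟨x, y, hx, hy, hxy⟩
      have hx' := (hcv _ _).1 hx
      have hy' := (hcv _ _).1 hy
      rcases h.ne_iff s t ⟨hl hx', hl hy'⟩ with ⟨h1, -⟩ | ⟨-, h1⟩
      · refine absurd (Subtype.ext (h.var _ _ ?_)) hxy
        exact h.trans _ _ _ ⟨h.symm _ _ hx', h.trans _ _ _ ⟨h1, hy'⟩⟩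
      · exact h1
  have hall : ∀ n, 1 ∈ φ n ↔ n ∈ atomicDiagram U := by
    intro n
    have h2 : n = 2 * Nat.pair (n / 2).unpair.1 (n / 2).unpair.2 ∨
        n = 2 * Nat.pair (n / 2).unpair.1 (n / 2).unpair.2 + 1 := by
      rw [Nat.pair_unpair]; omega
    rcases h2 with h2 | h2 <;> rw [h2]
    · exact heq _ _
    · exact hne _ _
  funext n
  by_cases hn : n ∈ atomicDiagram U
  · rw [Part.eq_some_iff.2 ((hall n).2 hn), Part.eq_some_iff.2 (one_mem_charFn.2 hn)]
  · rw [Part.eq_some_iff.2 ((h.total n).resolve_right (mt (hall n).1 hn)),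
      Part.eq_some_iff.2 (zero_mem_charFn.2 hn)]

theorem isRankOneDiagram_iff {X : Set ℕ} (h0 : 0 ∉ X) :
    IsRankOneDiagram X (charFn (atomicDiagram U)) ↔ IsRankOneDivisible X U := by
  have hv : ∀ x : U, CodeVal U (4 * x) x := fun x => codeVal_var.2 rfl
  have heq : ∀ {a b : ℕ} {x y : U}, CodeVal U a x → CodeVal U b y →
      (EqIn (charFn (atomicDiagram U)) a b ↔ x = y) := fun {a b x y} ha hb => by
    rw [eqIn_atomicDiagram]
    constructor
    · rintro ⟨z, h1, h2⟩
      exact (ha.unique h1).trans (h2.unique hb)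
    · rintro rfl
      exact ⟨x, ha, hb⟩
  have hone : CodeVal U 1 gOne := codeVal_one.2 rfl
  have hmul : ∀ {a b : ℕ} {x y : U}, CodeVal U a x → CodeVal U b y →
      CodeVal U (cMul a b) (gMul x y) := fun ha hb => codeVal_mul.2 ⟨_, _, ha, hb, rfl⟩
  have hinv : ∀ {a : ℕ} {x : U}, CodeVal U a x → CodeVal U (cInv a) (gInv x) :=
    fun ha => codeVal_inv.2 ⟨_, ha, rfl⟩
  have hself : ∀ x : U, EqIn (charFn (atomicDiagram U)) (4 * x) (4 * x) := fun x =>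
    (heq (hv x) (hv x)).2 rfl
  constructor
  · intro H
    have laws := fun x y z : U => H.laws (4 * x) (4 * y) (4 * z) ⟨hself x, hself y, hself z⟩
    refine ⟨fun x y z => ?_, fun x y => ?_, fun x => ?_, fun x => ?_, fun k x hx => ?_,
      fun x y => ?_, fun p hp x => ?_⟩
    · exact (heq (hmul (hmul (hv x) (hv y)) (hv z)) (hmul (hv x) (hmul (hv y) (hv z)))).1
        (laws x y z).1
    · exact (heq (hmul (hv x) (hv y)) (hmul (hv y) (hv x))).1 (laws x y y).2.1
    · exact (heq (hmul hone (hv x)) (hv x)).1 (laws x x x).2.2.1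
    · exact (heq (hmul (hinv (hv x)) (hv x)) hone).1 (laws x x x).2.2.2
    · exact (heq (hv x) hone).1 (H.torsionFree k _ ((heq ((hv x).pow _) hone).2 hx))
    · rcases H.rank (4 * x) (4 * y) ⟨hself x, hself y⟩ with h | ⟨n, h⟩
      · exact Or.inl ((heq (hv y) hone).1 h)
      · exact Or.inr ⟨_, _, h.imp (heq ((hv x).pow _) ((hv y).pow _)).1
          (heq (hmul ((hv x).pow _) ((hv y).pow _)) hone).1⟩
    · obtain ⟨t, ht⟩ := H.div p (4 * x) ⟨hp, hself x⟩
      obtain ⟨z, h1, h2⟩ := eqIn_atomicDiagram.1 ht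
      obtain ⟨y, hy, rfl⟩ := (codeVal_pow (fun h => h0 (h ▸ hp))).1 h1
      exact ⟨y, h2.unique (hv x)⟩
  · intro H
    refine ⟨?_, ?_, ?_, ?_⟩
    · simp only [eqIn_self_atomicDiagram]
      rintro s t r ⟨⟨x, hx⟩, ⟨y, hy⟩, ⟨z, hz⟩⟩
      exact ⟨(heq (hmul (hmul hx hy) hz) (hmul hx (hmul hy hz))).2 (H.assoc _ _ _),
        (heq (hmul hx hy) (hmul hy hx)).2 (H.comm _ _), (heq (hmul hone hx) hx).2 (H.one_mul _),
        (heq (hmul (hinv hx) hx) hone).2 (H.inv_mul _)⟩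
    · intro k s hs
      obtain ⟨z, h1, h2⟩ := eqIn_atomicDiagram.1 hs
      obtain ⟨y, hy, rfl⟩ := (codeVal_pow (Nat.succ_ne_zero k)).1 h1
      exact (heq hy hone).2 (H.torsionFree k y (codeVal_one.1 h2))
    · simp only [eqIn_self_atomicDiagram]
      rintro s t ⟨⟨x, hx⟩, ⟨y, hy⟩⟩
      rcases H.rank x y with h | ⟨m, n, h⟩
      · exact Or.inl ((heq hy hone).2 h)
      · refine Or.inr ⟨Nat.pair m n, ?_⟩
        rw [Nat.unpair_pair]
        exact h.imp (heq (hx.pow _) (hy.pow _)).2 (heq (hmul (hx.pow _) (hy.pow _)) hone).2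
    · simp only [eqIn_self_atomicDiagram]
      rintro p s ⟨hp, x, hx⟩
      obtain ⟨y, hy⟩ := H.div p hp x
      exact ⟨4 * y, (heq ((hv y).pow p) hx).2 hy⟩

/-- That `u` lies outside the universe is expressed positively, by the value `0` on its
self-equation, and `p = 0` is always available to report it. The negated condition then asks for
some `p ∉ X` with a c.e. property. -/
theorem hasBase_iff {X : Set ℕ} (h0 : 0 ∉ X) :
    HasBase X U ↔ ∃ u : ℕ, ¬ ∃ p ∉ X, (p = 0 ∨ p.Prime) ∧
      (0 ∈ charFn (atomicDiagram U) (2 * Nat.pair (4 * u) (4 * u)) ∨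
        ∃ y, EqIn (charFn (atomicDiagram U)) (cPow p (4 * y)) (4 * u)) := by
  simp only [zero_mem_charFn, mem_atomicDiagram_eq, eqIn_atomicDiagram, codeVal_var, and_self]
  constructor
  · rintro ⟨u, hu⟩
    refine ⟨u, ?_⟩
    rintro ⟨p, hp, hpp, h | ⟨y, z, h1, h2⟩⟩
    · exact h ⟨u, rfl⟩
    · obtain rfl : u = z := Subtype.ext h2
      rcases hpp with rfl | hpp
      · exact hu 0 hp (Or.inl rfl) u (codeVal_one.1 h1).symm
      · obtain ⟨y, hy, h⟩ := (codeVal_pow hpp.ne_zero).1 h1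
        exact hu p hp (Or.inr hpp) y h.symm
  · rintro ⟨u, hu⟩
    push Not at hu
    obtain ⟨x, rfl⟩ := (hu 0 h0 (Or.inl rfl)).1
    refine ⟨x, fun p hp hpp y hy => ?_⟩
    exact (hu p hp hpp).2 y x (hy ▸ (codeVal_var.2 rfl : CodeVal U (4 * y) y).pow p) rfl

end

/-! ### Complexity of the conditions on diagrams -/

theorem rePred_mem_partialComp {α : Type*} [Primcodable α] {f g : α → ℕ} (hf : Computable f)
    (hg : Computable g) (v : ℕ) : REPred fun a => v ∈ partialComp (f a) (g a) := by
  have h1 : Computable fun x : α × ℕ =>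
      Nat.Partrec.Code.evaln x.2 (Denumerable.ofNat Nat.Partrec.Code (f x.1)) (g x.1) :=
    Nat.Partrec.Code.primrec_evaln.to_comp.comp
      (f := fun a : (ℕ × Nat.Partrec.Code) × ℕ => Nat.Partrec.Code.evaln a.1.1 a.1.2 a.2)
      (g := fun x : α × ℕ => ((x.2, Denumerable.ofNat Nat.Partrec.Code (f x.1)), g x.1))
      ((Computable.snd.pair ((Computable.ofNat _).comp (hf.comp Computable.fst))).pair
        (hg.comp Computable.fst))
  have h2 : ComputablePred fun x : α × ℕ => v ∈ Nat.Partrec.Code.evaln x.2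
      (Denumerable.ofNat Nat.Partrec.Code (f x.1)) (g x.1) :=
    Computable.computablePred_of_bool
      ((Primrec.eq (α := Option ℕ)).decide.to_comp.comp h1 (Computable.const (some v)))
      fun a => by simp
  exact h2.to_re.exists_nat.of_eq fun a =>
    (Nat.Partrec.Code.evaln_complete (c := Denumerable.ofNat Nat.Partrec.Code (f a))
      (n := g a) (x := v)).symm

theorem rePred_eqIn {α : Type*} [Primcodable α] {f g h : α → ℕ} (hf : Computable f)
    (hg : Computable g) (hh : Computable h) :
    REPred fun a => EqIn (partialComp (f a)) (g a) (h a) :=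
  rePred_mem_partialComp hf (by fun_prop) 1

theorem REPred.exists_nat₂ {α : Type*} [Primcodable α] {p : α → ℕ → Prop}
    (hp : REPred fun x : α × ℕ => p x.1 x.2) : REPred fun a => ∃ n, p a n :=
  hp.exists_nat

/-- `p` is a `Π⁰_2` predicate. -/
def IsPi2 (p : ℕ → Prop) : Prop := IsSigma0 2 {e | ¬ p e}

namespace IsPi2
variable {p q : ℕ → Prop}

theorem congr (hp : IsPi2 p) (h : ∀ e, p e ↔ q e) : IsPi2 q := by
  rwa [show q = p from funext fun e => propext (h e).symm]

theorem and (hp : IsPi2 p) (hq : IsPi2 q) : IsPi2 fun e => p e ∧ q e := by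
  have := IsSigma0.union hp hq
  unfold IsPi2
  convert this using 1
  ext e
  simp [imp_iff_not_or]

/-- The negation asks for an `x` satisfying a `Σ⁰₁` and a `Π⁰₁` condition, and is therefore `Σ⁰₂`.
-/
theorem forall_imp {P Q : ℕ × ℕ → Prop} (hP : REPred P) (hQ : REPred Q) :
    IsPi2 fun e => ∀ x, P (e, x) → Q (e, x) := by
  have h1 : IsSigma0 2 {z : ℕ | P z.unpair} := IsSigma0.of_rePred (hP.comp Computable.unpair)
  have h2 : IsSigma0 1 {z : ℕ | Q z.unpair} := IsSigma0.of_rePred (hQ.comp Computable.unpair)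
  unfold IsPi2
  convert (h1.inter h2.compl_succ).exists_nat using 1
  ext e
  simp

theorem forall_imp₂ {P Q : ℕ × ℕ × ℕ → Prop} (hP : REPred P) (hQ : REPred Q) :
    IsPi2 fun e => ∀ x y, P (e, x, y) → Q (e, x, y) := by
  have := forall_imp (hP.comp (f := fun x : ℕ × ℕ => (x.1, x.2.unpair)) (by fun_prop))
    (hQ.comp (f := fun x : ℕ × ℕ => (x.1, x.2.unpair)) (by fun_prop))
  refine this.congr fun e => ?_
  exact ⟨fun H x y => by simpa using H (Nat.pair x y), fun H x => H _ _⟩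

theorem forall_imp₃ {P Q : ℕ × ℕ × ℕ × ℕ → Prop} (hP : REPred P) (hQ : REPred Q) :
    IsPi2 fun e => ∀ x y z, P (e, x, y, z) → Q (e, x, y, z) := by
  have := forall_imp₂ (hP.comp (f := fun x : ℕ × ℕ × ℕ => (x.1, x.2.1, x.2.2.unpair)) (by fun_prop))
    (hQ.comp (f := fun x : ℕ × ℕ × ℕ => (x.1, x.2.1, x.2.2.unpair)) (by fun_prop))
  refine this.congr fun e => forall_congr' fun x => ?_
  exact ⟨fun H y z => by simpa using H (Nat.pair y z), fun H y => H _ _⟩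

theorem forall_imp₄ {P Q : ℕ × ℕ × ℕ × ℕ × ℕ → Prop} (hP : REPred P) (hQ : REPred Q) :
    IsPi2 fun e => ∀ x y z w, P (e, x, y, z, w) → Q (e, x, y, z, w) := by
  have := forall_imp₃
    (hP.comp (f := fun x : ℕ × ℕ × ℕ × ℕ => (x.1, x.2.1, x.2.2.1, x.2.2.2.unpair)) (by fun_prop))
    (hQ.comp (f := fun x : ℕ × ℕ × ℕ × ℕ => (x.1, x.2.1, x.2.2.1, x.2.2.2.unpair)) (by fun_prop))
  refine this.congr fun e => forall_congr' fun x => forall_congr' fun y => ?_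
  exact ⟨fun H z w => by simpa using H (Nat.pair z w), fun H z => H _ _⟩

theorem of_rePred (h : REPred p) : IsPi2 p := by
  have h1 : IsSigma0 1 {e : ℕ | p e} := IsSigma0.of_rePred h
  exact h1.compl_succ

theorem forall_nat {Q : ℕ × ℕ → Prop} (hQ : REPred Q) : IsPi2 fun e => ∀ x, Q (e, x) := by
  have hT : ComputablePred fun _ : ℕ × ℕ => True :=
    Computable.computablePred_of_bool (Computable.const true) (by simp)
  simpa using forall_imp hT.to_re hQ

end IsPi2

theorem rePred_false {α : Type*} [Primcodable α] : REPred fun _ : α => False :=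
  (Computable.computablePred_of_bool (Computable.const false) (by simp)).to_re

/-- Every clause of `IsDiagram` was phrased positively in values of `φ` on each side of its
implication, so `forall_imp` and its variants apply clause by clause, even when `partialComp e` is
not total. -/
theorem isPi2_isDiagram : IsPi2 fun e => IsDiagram (partialComp e) := by
  have total : IsPi2 fun e => ∀ n, 0 ∈ partialComp e n ∨ 1 ∈ partialComp e n :=
    .forall_nat (Q := fun x => 0 ∈ partialComp x.1 x.2 ∨ 1 ∈ partialComp x.1 x.2)
      ((rePred_mem_partialComp (by fun_prop) (by fun_prop) _).or
        (rePred_mem_partialComp (by fun_prop) (by fun_prop) _))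
  have var : IsPi2 fun e => ∀ a b, EqIn (partialComp e) (4 * a) (4 * b) → a = b :=
    .forall_imp₂ (P := fun x => EqIn (partialComp x.1) (4 * x.2.1) (4 * x.2.2))
      (Q := fun x => x.2.1 = x.2.2) (rePred_eqIn (by fun_prop) (by fun_prop) (by fun_prop))
      (ComputablePred.natEq (by fun_prop) (by fun_prop)).to_re
  have rest : IsPi2 fun e => _ :=
    (IsPi2.forall_imp₂ (P := fun x => EqIn (partialComp x.1) x.2.1 x.2.1 ∧ EqIn (partialComp x.1) x.2.2 x.2.2)
      (Q := fun x => (EqIn (partialComp x.1) x.2.1 x.2.2 ∧ 0 ∈ partialComp x.1 (2 * Nat.pair x.2.1 x.2.2 + 1)) ∨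
        (0 ∈ partialComp x.1 (2 * Nat.pair x.2.1 x.2.2) ∧ 1 ∈ partialComp x.1 (2 * Nat.pair x.2.1 x.2.2 + 1)))
      ?_ ?_).and <|
    (IsPi2.forall_imp₂ (P := fun x => 1 ∈ partialComp x.1 (2 * Nat.pair x.2.1 x.2.2 + 1))
      (Q := fun x => EqIn (partialComp x.1) x.2.1 x.2.1 ∧ EqIn (partialComp x.1) x.2.2 x.2.2) ?_ ?_).and <|
    (IsPi2.forall_imp₂ (P := fun x => EqIn (partialComp x.1) x.2.1 x.2.2)
      (Q := fun x => EqIn (partialComp x.1) x.2.2 x.2.1) ?_ ?_).and <|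
    (IsPi2.forall_imp₃ (P := fun x => EqIn (partialComp x.1) x.2.1 x.2.2.1 ∧ EqIn (partialComp x.1) x.2.2.1 x.2.2.2)
      (Q := fun x => EqIn (partialComp x.1) x.2.1 x.2.2.2) ?_ ?_).and <|
    (IsPi2.forall_imp₂ (P := fun x => EqIn (partialComp x.1) x.2.1 x.2.2)
      (Q := fun x => EqIn (partialComp x.1) (cInv x.2.1) (cInv x.2.2)) ?_ ?_).and <|
    (IsPi2.forall_imp₄
      (P := fun x => EqIn (partialComp x.1) x.2.1 x.2.2.1 ∧ EqIn (partialComp x.1) x.2.2.2.1 x.2.2.2.2)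
      (Q := fun x => EqIn (partialComp x.1) (cMul x.2.1 x.2.2.2.1) (cMul x.2.2.1 x.2.2.2.2)) ?_ ?_).and <|
    (IsPi2.of_rePred (p := fun e => EqIn (partialComp e) 1 1) ?_).and <|
    (IsPi2.forall_imp (P := fun x => EqIn (partialComp x.1) (4 * x.2 + 5) (4 * x.2 + 5))
      (Q := fun _ => False) ?_ ?_).and <|
    (IsPi2.forall_imp (P := fun x => EqIn (partialComp x.1) (cInv x.2) (cInv x.2))
      (Q := fun x => EqIn (partialComp x.1) x.2 x.2) ?_ ?_).and <|
    (IsPi2.forall_imp₂ (P := fun x => EqIn (partialComp x.1) (cMul x.2.1 x.2.2) (cMul x.2.1 x.2.2))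
      (Q := fun x => EqIn (partialComp x.1) x.2.1 x.2.1 ∧ EqIn (partialComp x.1) x.2.2 x.2.2) ?_ ?_).and <|
    (IsPi2.forall_imp (P := fun x => EqIn (partialComp x.1) x.2 x.2)
      (Q := fun x => ∃ a, EqIn (partialComp x.1) x.2 (4 * a)) ?_ ?_)
  · exact ((total.and var).and rest).congr fun e =>
      ⟨fun ⟨⟨h1, h12⟩, h2, h3, h4, h5, h6, h7, h8, h9, h10, h11, h13⟩ =>
        ⟨h1, h2, h3, h4, h5, h6, h7, h8, h9, h10, h11, h12, h13⟩,
      fun ⟨h1, h2, h3, h4, h5, h6, h7, h8, h9, h10, h11, h12, h13⟩ =>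
        ⟨⟨h1, h12⟩, h2, h3, h4, h5, h6, h7, h8, h9, h10, h11, h13⟩⟩
  all_goals
    repeat' first
      | with_reducible apply REPred.and
      | with_reducible apply REPred.or
      | with_reducible apply REPred.exists_nat₂
      | with_reducible apply rePred_eqIn
      | with_reducible apply rePred_mem_partialComp
      | exact rePred_false
      | fun_prop

theorem isPi2_isRankOneDiagram {X : Set ℕ} (hX : REPred fun p => p ∈ X) :
    IsPi2 fun e => IsRankOneDiagram X (partialComp e) := by
  have h : IsPi2 fun e => _ :=
    (IsPi2.forall_imp₃ (P := fun x => EqIn (partialComp x.1) x.2.1 x.2.1 ∧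
        EqIn (partialComp x.1) x.2.2.1 x.2.2.1 ∧ EqIn (partialComp x.1) x.2.2.2 x.2.2.2)
      (Q := fun x =>
        EqIn (partialComp x.1) (cMul (cMul x.2.1 x.2.2.1) x.2.2.2) (cMul x.2.1 (cMul x.2.2.1 x.2.2.2)) ∧
        EqIn (partialComp x.1) (cMul x.2.1 x.2.2.1) (cMul x.2.2.1 x.2.1) ∧
        EqIn (partialComp x.1) (cMul 1 x.2.1) x.2.1 ∧ EqIn (partialComp x.1) (cMul (cInv x.2.1) x.2.1) 1) ?_ ?_).and <|
    (IsPi2.forall_imp₂ (P := fun x => EqIn (partialComp x.1) (cPow (x.2.1 + 1) x.2.2) 1)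
      (Q := fun x => EqIn (partialComp x.1) x.2.2 1) ?_ ?_).and <|
    (IsPi2.forall_imp₂ (P := fun x => EqIn (partialComp x.1) x.2.1 x.2.1 ∧ EqIn (partialComp x.1) x.2.2 x.2.2)
      (Q := fun x => EqIn (partialComp x.1) x.2.2 1 ∨ ∃ n : ℕ,
        EqIn (partialComp x.1) (cPow (n.unpair.1 + 1) x.2.1) (cPow n.unpair.2 x.2.2) ∨
        EqIn (partialComp x.1) (cMul (cPow (n.unpair.1 + 1) x.2.1) (cPow n.unpair.2 x.2.2)) 1) ?_ ?_).and <|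
    (IsPi2.forall_imp₂ (P := fun x => x.2.1 ∈ X ∧ EqIn (partialComp x.1) x.2.2 x.2.2)
      (Q := fun x => ∃ t, EqIn (partialComp x.1) (cPow x.2.1 t) x.2.2) ?_ ?_)
  · exact h.congr fun e => ⟨fun ⟨h1, h2, h3, h4⟩ => ⟨h1, h2, h3, h4⟩,
      fun ⟨h1, h2, h3, h4⟩ => ⟨h1, h2, h3, h4⟩⟩
  all_goals
    repeat' first
      | with_reducible apply REPred.and
      | with_reducible apply REPred.or
      | with_reducible apply REPred.exists_nat₂
      | with_reducible apply rePred_eqIn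
      | with_reducible apply rePred_mem_partialComp
      | exact rePred_false
      | with_reducible exact hX.comp (f := fun x : ℕ × ℕ × ℕ => x.2.1) (by fun_prop)
      | fun_prop

/-! ### The index set -/

/-- The pairs `⟨e, u⟩` such that, in the structure with index `e`, the number `u` is not an element
that is nontrivial and not divisible by any prime outside `X`. -/
def nonBase (X : Set ℕ) : Set ℕ := {z | ∃ p ∉ X, (p = 0 ∨ p.Prime) ∧
  (0 ∈ partialComp z.unpair.1 (2 * Nat.pair (4 * z.unpair.2) (4 * z.unpair.2)) ∨
    ∃ y, EqIn (partialComp z.unpair.1) (cPow p (4 * y)) (4 * z.unpair.2))}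

theorem ceIn_nonBase (X : Set ℕ) : CEIn X (nonBase X) := by
  have h1 : ComputablePred fun x : ℕ × ℕ => x.2 = 0 ∨ x.2.Prime :=
    (ComputablePred.natEq (by fun_prop) (by fun_prop)).or
      (computablePred_prime.comp (f := fun x : ℕ × ℕ => x.2) (by fun_prop))
  exact CEIn.exists_notMem (Y := X) (h1.to_re.and
    ((rePred_mem_partialComp (f := fun x : ℕ × ℕ => x.1.unpair.1)
      (g := fun x => 2 * Nat.pair (4 * x.1.unpair.2) (4 * x.1.unpair.2))
      (by fun_prop) (by fun_prop) 0).or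
    (REPred.exists_nat₂ (p := fun (x : ℕ × ℕ) y => EqIn (partialComp x.1.unpair.1)
      (cPow x.2 (4 * y)) (4 * x.1.unpair.2))
      (rePred_eqIn (by fun_prop) (by fun_prop) (by fun_prop)))))

/-- A set c.e. in `X` reduces to `jump X`, so the oracle `jump X` can confirm non-membership. -/
theorem CEIn.exists_pair_notMem {X R : Set ℕ} (h : CEIn X R) :
    CEIn (jump X) {a | ∃ x, Nat.pair a x ∉ R} := by
  obtain ⟨f, hf, h⟩ := h.exists_reduction
  have h1 : REPred fun z : ℕ × ℕ => ∃ x, z.2 = f (Nat.pair z.1 x) :=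
    REPred.exists_nat₂ (p := fun (z : ℕ × ℕ) x => z.2 = f (Nat.pair z.1 x))
      (ComputablePred.natEq (by fun_prop) (by fun_prop)).to_re
  convert CEIn.exists_notMem (Y := jump X) h1 using 1
  ext a
  simp only [h, Set.mem_ofPred_eq]
  exact ⟨fun ⟨x, hx⟩ => ⟨_, hx, x, rfl⟩, fun ⟨p, hp, x, hx⟩ => ⟨x, hx ▸ hp⟩⟩

theorem IsSigma0.ceIn_jump {S : Set ℕ} (h : IsSigma0 2 S) (X : Set ℕ) : CEIn (_root_.jump X) S := by
  obtain ⟨R, hR, h⟩ := h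
  convert (CEIn.of_rePred (Y := X) (IsSigma0.rePred hR)).exists_pair_notMem using 1
  ext a
  rw [h]
  rfl

section
variable {G : AddSubgroup ℚ} {u : G} {X : Set ℕ}

theorem zero_notMem_of_primesInf (hinf : primesInf u = X) : 0 ∉ X := fun h => by
  rw [← hinf] at h
  exact Nat.not_prime_zero h.1

/-- This separates a `Π⁰₂` condition from one that is c.e. in `jump X`, the decomposition behind
both conclusions about the index set. -/
theorem mem_indexSet_iff (hu : u ≠ 0) (hfin : primesFin u = ∅) (hinf : primesInf u = X) (e : ℕ) :
    e ∈ indexSet G ↔ (IsDiagram (partialComp e) ∧ IsRankOneDiagram X (partialComp e)) ∧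
      ∃ v, Nat.pair e v ∉ nonBase X := by
  have h0 := zero_notMem_of_primesInf hinf
  simp only [nonBase, Set.mem_ofPred_eq, Nat.unpair_pair]
  constructor
  · rintro ⟨U, _, he, hG⟩
    rw [he]
    obtain ⟨h1, h2⟩ := (nonempty_equiv_iff hu hfin hinf U).1 hG
    exact ⟨⟨isDiagram_atomicDiagram U, (isRankOneDiagram_iff h0).2 h1⟩, (hasBase_iff h0).1 h2⟩
  · rintro ⟨⟨h1, h2⟩, h3⟩
    obtain ⟨U, _, he⟩ := h1.exists_structure
    rw [he] at h2 h3
    exact ⟨U, _, he, (nonempty_equiv_iff hu hfin hinf U).2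
      ⟨(isRankOneDiagram_iff h0).1 h2, (hasBase_iff h0).2 h3⟩⟩

/-- In a computable copy, one searches for an element whose `p`-th power is the image of `u`; by
`mem_primesInf_iff` a single success decides for all powers of `p`. -/
theorem rePred_of_isComputableStructure (hG : IsComputableStructure G) (hfin : primesFin u = ∅)
    (hinf : primesInf u = X) : REPred fun p => p ∈ X := by
  obtain ⟨U, _, hD, ⟨f⟩⟩ := hG
  obtain ⟨v, rfl⟩ := f.surjective u
  have h1 : REPred fun p : ℕ => p.Prime ∧ ∃ b, 2 * Nat.pair (cPow p (4 * b)) (4 * v) ∈ atomicDiagram U :=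
    computablePred_prime.to_re.and (REPred.exists_nat₂
      (p := fun p b => 2 * Nat.pair (cPow p (4 * b)) (4 * v) ∈ atomicDiagram U)
      (hD.comp (f := fun x : ℕ × ℕ => 2 * Nat.pair (cPow x.1 (4 * x.2)) (4 * v)) (by fun_prop)).to_re)
  refine h1.of_eq fun p => ?_
  rw [← hinf, mem_primesInf_iff hfin]
  refine and_congr_right fun hp => ?_
  simp only [mem_atomicDiagram_eq, codeVal_var, ← gPow_eq_nsmul]
  constructor
  · rintro ⟨b, z, h1, h2⟩
    obtain rfl : v = z := Subtype.ext h2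
    obtain ⟨y, -, h⟩ := (codeVal_pow hp.ne_zero).1 h1
    exact ⟨f y, by rw [← equiv_gPow, ← h]⟩
  · rintro ⟨y, hy⟩
    obtain ⟨y, rfl⟩ := f.surjective y
    rw [← equiv_gPow] at hy
    exact ⟨y, v, f.injective hy ▸ (codeVal_var.2 rfl : CodeVal U (4 * y) y).pow p, rfl⟩

end

theorem turingLe_of_reduction_sdiff {T A B J : Set ℕ} {k f g : ℕ → ℕ} (hk : Computable k)
    (hf : Computable f) (hg : Computable g) (hT : ∀ a, a ∈ T ↔ k a ∈ A \ B)
    (hA : ∀ a, a ∈ A ↔ f a ∈ J) (hB : ∀ a, a ∈ B ↔ g a ∈ J) : TuringLe T J := by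
  -- `F` receives the oracle's answers about `A` and `B` and returns the characteristic value of the
  -- difference.
  let F : ℕ → ℕ := fun z => bif decide (z.unpair.2 = 1) then 0 else z.unpair.1
  have hF : Computable F := by fun_prop
  have h := (RecTotal.of_computable (Y := J) hF).comp
    (((RecTotal.chi J).comp (.of_computable (hf.comp hk))).pair
      ((RecTotal.chi J).comp (.of_computable (hg.comp hk))))
  refine turingLe_of_recTotal ?_
  convert h using 2 with a
  simp only [F, Nat.unpair_pair]
  by_cases h1 : f (k a) ∈ J <;> by_cases h2 : g (k a) ∈ J <;>
    simp [chi, hT, hA, hB, h1, h2]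

theorem mainTheorem9 (G : AddSubgroup ℚ) (hG : IsComputableStructure G)
    (u : G) (hu : u ≠ 0) (X : Set ℕ)
    (hfin : primesFin u = ∅) (hinf : primesInf u = X) :
    REPred (fun p => p ∈ X) ∧
    (∃ φ ψ : InfSentence, IsComputablePi 2 φ ∧ IsRelComputableSigma X 2 ψ ∧
      IsScottConj φ ψ G) ∧
    (IsLow X → IsDSigma02 (indexSet G)) ∧
    (¬ IsTwoHigh X → ¬ IsMCompleteSigma0 3 (indexSet G)) := by
  have hX := rePred_of_isComputableStructure hG hfin hinf
  have hA : CEIn (jump X) {e | ∃ v, Nat.pair e v ∉ nonBase X} := (ceIn_nonBase X).exists_pair_notMem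
  have hB : IsSigma0 2 {e | ¬ (IsDiagram (partialComp e) ∧ IsRankOneDiagram X (partialComp e))} :=
    isPi2_isDiagram.and (isPi2_isRankOneDiagram hX)
  have hI : indexSet G = {e | ∃ v, Nat.pair e v ∉ nonBase X} \
      {e | ¬ (IsDiagram (partialComp e) ∧ IsRankOneDiagram X (partialComp e))} := by
    ext e
    rw [mem_indexSet_iff hu hfin hinf, Set.mem_sdiff, Set.mem_ofPred_eq, Set.mem_ofPred_eq, not_not,
      and_comm]
  refine ⟨hX, ?_, fun hlow => ?_, fun hhigh hcomp => hhigh ?_⟩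
  · obtain ⟨φ, hφ, hφr⟩ := exists_computablePi hX
    obtain ⟨ψ, hψ, hψr⟩ := exists_relComputableSigma X
    refine ⟨φ, ψ, hφ, hψ, fun N _ _ => ?_⟩
    rw [hφr, hψr, nonempty_equiv_iff hu hfin hinf]
  -- Lowness turns `jump X` into an oracle below `jump ∅`, which is `Σ⁰₁`; a set c.e. in it is
  -- `Σ⁰₂`.
  · exact ⟨_, _, (IsSigma0.empty (n := 0)).jump.of_ceIn (hA.trans hlow.2.1), hB, hI⟩
  · have hX' : TuringLe X (jump ∅) := (CEIn.of_rePred hX).turingLe_jump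
    refine ⟨hX', hX'.jump.jump, ?_⟩
    -- The third jump of `∅` is `Σ⁰₃`, so completeness would reduce it to the index set, which is
    -- decided by two questions to `jump (jump X)`.
    obtain ⟨k, hk, hT⟩ := hcomp.2 _ (IsSigma0.empty (n := 0)).jump.jump.jump
    obtain ⟨f, hf, hfA⟩ := hA.exists_reduction
    obtain ⟨g, hg, hgB⟩ := (hB.ceIn_jump X).exists_reduction
    exact turingLe_of_reduction_sdiff hk hf hg (fun a => by rw [← hI]; exact hT a) hfA hgB
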